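/- Let $X$ be a real or complex Banach space with an unconditional Schauder basis $(e_n)_{n\in\mathbb N}$. A block-basis of a sequence $(y_n)$ is a sequence of non-trivial finite linear combinations of the $y_n$ with successive supports; its closed linear span is called a block-subspace of $[y_n]$. Assume that: (a) $X$ is countably homogeneous, i.e. $X$ has at most countably many closed subspaces up to (linear, bicontinuous) isomorphism; (b) $X$ is hereditarily block-minimal, i.e. for every block-basis $y$ of $(e_n)$ and every block-basis $z$ of $y$ there is a block-basis $w$ of $z$ with $[w]\simeq[y]$. Let $\mathbf Q$ be the countable set of norm-one vectors of the form $r\sum_i a_i e_i$ with $r\in\mathbb R$ and $(a_i)$ a finitely supported sequence with values in $\mathbb Q$ (in $\mathbb Q+i\mathbb Q$ in the complex case), and let $bb_d(X)$ be the set of block-bases of $(e_n)$ with terms in $\mathbf Q$, with the topology induced by the product of the discrete topologies on $\mathbf Q$. Two elements $x,y$ of $bb_d(X)$ are isomorphic if $[x]\simeq[y]$. Then exactly one isomorphism class of $bb_d(X)$ is residual (comeagre) in $bb_d(X)$. Moreover, for every $x$ in this residual class one can choose an element $y_c\in bb_d(X)$ of each isomorphism class $c$ of $bb_d(X)$ such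 that $[x]$ is isomorphic to a (possibly infinite) direct sum of the spaces $[y_c]$; precisely, $[x]$ is isomorphic to a closed subspace $S$ of $X$ containing all the $[y_c]$ and such that every $s\in S$ can be written in a unique way as $s=\sum_c s_c$ with $s_c\in[y_c]$ for every $c$, the series being unconditionally convergent. -/

import Mathlib

open Filter Topology

section BlockSequences

variable (𝕜 : Type*) [RCLike 𝕜] {X : Type*} [NormedAddCommGroup X] [NormedSpace 𝕜 X]

/-- The closed linear span `[y]` of a sequence `y`. -/
def closedSpan (y : ℕ → X) : Submodule 𝕜 X :=
  (Submodule.span 𝕜 (Set.range y)).topologicalClosure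

/-- Two subspaces are isomorphic: there is a linear homeomorphism between them. -/
def SubspaceIso (V W : Submodule 𝕜 X) : Prop :=
  Nonempty (V ≃L[𝕜] W)

/-- `z` is a blocking of `y`: the terms of `z` are non-trivial finite linear combinations of
terms of `y`, with successive supports. (For a basis `e`, the blockings of `e` are its
block-bases, and a blocking of a block-basis is a block-basis of that block-basis.) -/
def IsBlocking (y z : ℕ → X) : Prop :=
  ∃ a : ℕ → ℕ →₀ 𝕜,
    (∀ n, a n ≠ 0 ∧ z n = Finsupp.linearCombination 𝕜 y (a n)) ∧
    ∀ n, ∀ i ∈ (a n).support, ∀ j ∈ (a (n + 1)).support, i < j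

/-- The space `[y]`, with basis `y`, is block-minimal: every block-subspace has a further
block-subspace isomorphic to `[y]`. -/
def IsBlockMinimal (y : ℕ → X) : Prop :=
  ∀ z, IsBlocking 𝕜 y z →
    ∃ w, IsBlocking 𝕜 z w ∧ SubspaceIso 𝕜 (closedSpan 𝕜 w) (closedSpan 𝕜 y)

/-- The space with basis `e` is hereditarily block-minimal: each of its block-subspaces, with
its block-basis as basis, is block-minimal. -/
def IsHereditarilyBlockMinimal (e : ℕ → X) : Prop :=
  ∀ y, IsBlocking 𝕜 e y → IsBlockMinimal 𝕜 y

variable (X) in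
/-- `X` has at most countably many closed subspaces up to isomorphism. (Finite-dimensional
subspaces, which only contribute countably many isomorphism classes, are not excluded.) -/
def IsCountablyHomogeneous : Prop :=
  ∃ W : ℕ → Submodule 𝕜 X, ∀ V : Submodule 𝕜 X,
    IsClosed (V : Set X) → ∃ n, IsClosed (W n : Set X) ∧ SubspaceIso 𝕜 V (W n)

/-- Rational scalars: elements of `ℚ` if `𝕜 = ℝ`, of `ℚ + iℚ` if `𝕜 = ℂ`. -/
def IsRationalScalar (t : 𝕜) : Prop :=
  ∃ p q : ℚ, t = (p : 𝕜) + (q : 𝕜) * RCLike.I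

/-- The set `𝐐` of normalized blocks of `e` that are real multiples of a block with rational
coordinates. -/
def NormalizedRationalBlock (e : ℕ → X) : Type _ :=
  {x : X // ‖x‖ = 1 ∧ ∃ (r : ℝ) (a : ℕ →₀ 𝕜),
    (∀ i, IsRationalScalar 𝕜 (a i)) ∧ x = (r : 𝕜) • Finsupp.linearCombination 𝕜 e a}

/-- `𝐐` carries the discrete topology. -/
instance (e : ℕ → X) : TopologicalSpace (NormalizedRationalBlock 𝕜 e) := ⊥

instance (e : ℕ → X) : DiscreteTopology (NormalizedRationalBlock 𝕜 e) := ⟨rfl⟩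

/-- `bb_d`: the set of block-bases of `e` whose terms are vectors in `𝐐`. -/
def BlockBasesD (e : ℕ → X) : Type _ :=
  {x : ℕ → NormalizedRationalBlock 𝕜 e // IsBlocking 𝕜 e (fun n => (x n).1)}

/-- The topology of `bb_d` is induced by the product of the discrete topologies. -/
instance (e : ℕ → X) : TopologicalSpace (BlockBasesD 𝕜 e) :=
  inferInstanceAs (TopologicalSpace
    {x : ℕ → NormalizedRationalBlock 𝕜 e // IsBlocking 𝕜 e (fun n => (x n).1)})

variable {𝕜}

/-- The block-subspace spanned by an element of `bb_d`. -/
def BlockBasesD.space {e : ℕ → X} (x : BlockBasesD 𝕜 e) : Submodule 𝕜 X :=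
  closedSpan 𝕜 (fun n => (x.1 n).1)

variable (𝕜)

/-- The relation of isomorphism on `bb_d`. -/
def BlockBasesD.isoSetoid (e : ℕ → X) : Setoid (BlockBasesD 𝕜 e) where
  r x y := SubspaceIso 𝕜 x.space y.space
  iseqv :=
    { refl := fun _ => ⟨ContinuousLinearEquiv.refl _ _⟩
      symm := fun ⟨f⟩ => ⟨f.symm⟩
      trans := fun ⟨f⟩ ⟨g⟩ => ⟨f.trans g⟩ }

/-- The set of isomorphism classes of `bb_d`. -/
def IsoClass (e : ℕ → X) : Type _ :=
  Quotient (BlockBasesD.isoSetoid 𝕜 e)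

variable {𝕜}

/-- The isomorphism class of an element of `bb_d`. -/
def BlockBasesD.isoClass {e : ℕ → X} (x : BlockBasesD 𝕜 e) : IsoClass 𝕜 e :=
  Quotient.mk (BlockBasesD.isoSetoid 𝕜 e) x

/-- The class `c` is residual (comeagre) in `bb_d`. -/
def IsResidualClass {e : ℕ → X} (c : IsoClass 𝕜 e) : Prop :=
  {x : BlockBasesD 𝕜 e | x.isoClass = c} ∈ residual (BlockBasesD 𝕜 e)

/-- The closed subspace `S` is the (possibly infinite) direct sum of the closed subspaces `E i`:
every element of `S` is in a unique way the sum of an unconditionally convergent series with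
terms in the `E i`. (For a finite family this is the usual topological direct sum.) -/
def IsUnconditionalDirectSum {ι : Type*} (E : ι → Submodule 𝕜 X) (S : Submodule 𝕜 X) : Prop :=
  IsClosed (S : Set X) ∧ (∀ i, IsClosed (E i : Set X)) ∧ (∀ i, E i ≤ S) ∧
    ∀ x ∈ S, ∃! f : ι → X, (∀ i, f i ∈ E i) ∧ HasSum f x

end BlockSequences

/-! Unconditionality makes the coordinate projection onto any set of indices bounded, so for a
disjointly supported sequence, disjoint sets of indices span complementary subspaces
(`famSpan_union`, `isUnconditionalDirectSum`). Replacing finitely many terms by equally many others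
then does not change the isomorphism type.

Countable homogeneity enters through a zero-one law (`exists_residual_class`). Isomorphism classes
are analytic; there are countably many of them, so each is Borel, and by Baire one is non-meagre. If
class-preserving homeomorphisms can move any open set to meet any other, that class is comeagre.
Exchanging prefixes supplies such homeomorphisms, both on the Cantor space of subsequences of a
sequence `v` and on `bb_d`, where the law yields the residual class.

On the Cantor space, a comeagre class contains every set that agrees infinitely often with a fixed
pattern on successive intervals (`exists_pattern`). Let `H` be the common span. Pattern blocks taken
on the even or on the odd intervals, or on all of them, each span `H`, so `H ≃ H × H`. The set of
all indices is the union of two complementary sets that both match the pattern infinitely often, so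
`[v] ≃ H × H ≃ H`. Hence `[v]` is isomorphic to its square and to the span of any infinite
collection of its pattern blocks (`exists_blocks_and_square`).

A generic block-basis `t` contains arbitrarily late pattern blocks of a representative of every
class. Since there are countably many classes, bookkeeping separates these blocks into disjoint
subsequences of `t`, one for each class; let `S` be the span of their union. Then `S` is
complemented in `[t]`, while `[t]` is isomorphic to a complemented part of `S`, namely the summand
of its own class. Both are isomorphic to their squares, so Pełczyński's decomposition method
(`nonempty_of_absorbing`) gives `[t] ≃ S`. -/

/-! ### Coordinate projections and spans of disjointly supported sequences -/

section UnconditionalBases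

variable {𝕜 : Type*} [RCLike 𝕜] {X : Type*} [NormedAddCommGroup X] [NormedSpace 𝕜 X]

/-- The set of indices at which `x` has a non-zero coordinate. -/
def coordSupport (b : UnconditionalSchauderBasis ℕ 𝕜 X) (x : X) : Set ℕ :=
  {i | b.coord i x ≠ 0}

theorem summable_indicator_expansion [CompleteSpace X] (b : UnconditionalSchauderBasis ℕ 𝕜 X)
    (T : Set ℕ) (x : X) : Summable (T.indicator fun i => b.coord i x • b.basis i) :=
  (b.expansion x).summable.indicator T

/-- The projection onto the closed span of the basis vectors with index in `T`. -/
noncomputable def coordProj [CompleteSpace X] (b : UnconditionalSchauderBasis ℕ 𝕜 X)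
    (T : Set ℕ) : X →L[𝕜] X :=
  LinearMap.mkContinuousOfExistsBound
    { toFun := fun x => ∑' i, T.indicator (fun i => b.coord i x • b.basis i) i
      map_add' := fun x y => by
        rw [← (summable_indicator_expansion b T x).tsum_add (summable_indicator_expansion b T y)]
        refine tsum_congr fun i => ?_
        by_cases hi : i ∈ T <;> simp [hi, add_smul]
      map_smul' := fun c x => by
        rw [RingHom.id_apply, ← (summable_indicator_expansion b T x).tsum_const_smul c]
        refine tsum_congr fun i => ?_
        by_cases hi : i ∈ T <;> simp [hi, mul_smul] }
    (by
      classical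
      obtain ⟨C, hC⟩ := UnconditionalSchauderBasis.exists_norm_proj_le b
      refine ⟨C, fun x => ?_⟩
      refine le_of_tendsto' ((summable_indicator_expansion b T x).hasSum.norm) fun A => ?_
      -- Partial sums are finite basis projections, whose norms are uniformly bounded by
      -- unconditionality; the bound passes to the limit.
      have : ∑ i ∈ A, T.indicator (fun i => b.coord i x • b.basis i) i
          = GeneralSchauderBasis.proj b (A.filter (· ∈ T)) x := by
        rw [GeneralSchauderBasis.proj_apply, Finset.sum_filter]
        exact Finset.sum_congr rfl fun i _ => by by_cases hi : i ∈ T <;> simp [hi]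
      rw [this]
      exact (ContinuousLinearMap.le_opNorm _ _).trans
        (mul_le_mul_of_nonneg_right (hC _) (norm_nonneg _)))

theorem hasSum_coordProj [CompleteSpace X] (b : UnconditionalSchauderBasis ℕ 𝕜 X)
    (T : Set ℕ) (x : X) :
    HasSum (T.indicator fun i => b.coord i x • b.basis i) (coordProj b T x) :=
  (summable_indicator_expansion b T x).hasSum

theorem coordProj_eq_self [CompleteSpace X] (b : UnconditionalSchauderBasis ℕ 𝕜 X)
    {T : Set ℕ} {x : X} (h : coordSupport b x ⊆ T) : coordProj b T x = x := by
  refine (hasSum_coordProj b T x).unique ?_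
  convert b.expansion x using 1
  funext i
  by_cases hi : i ∈ T
  · simp [hi]
  · have : b.coord i x = 0 := by
      by_contra h0
      exact hi (h h0)
    simp [this]

theorem coordProj_eq_zero [CompleteSpace X] (b : UnconditionalSchauderBasis ℕ 𝕜 X)
    {T : Set ℕ} {x : X} (h : Disjoint (coordSupport b x) T) : coordProj b T x = 0 := by
  refine (hasSum_coordProj b T x).unique ?_
  convert (hasSum_zero : HasSum (fun _ : ℕ => (0 : X)) 0) using 1
  funext i
  by_cases hi : i ∈ T
  · have : b.coord i x = 0 := by
      by_contra h0
      exact Set.disjoint_left.1 h h0 hi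
    simp [this]
  · simp [hi]

theorem GeneralSchauderBasis.separableSpace (b : UnconditionalSchauderBasis ℕ 𝕜 X) :
    TopologicalSpace.SeparableSpace X := by
  have hs : TopologicalSpace.IsSeparable ((Submodule.span 𝕜 (Set.range b.basis) : Submodule 𝕜 X) : Set X) :=
    TopologicalSpace.IsSeparable.span (Set.countable_range _).isSeparable
  have : closure ((Submodule.span 𝕜 (Set.range b.basis) : Submodule 𝕜 X) : Set X) = Set.univ := by
    refine Set.eq_univ_of_forall fun x => ?_
    refine mem_closure_of_tendsto (b.expansion x) (Eventually.of_forall fun A => ?_)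
    exact Submodule.sum_mem _ fun i _ =>
      Submodule.smul_mem _ _ (Submodule.subset_span ⟨i, rfl⟩)
  exact TopologicalSpace.isSeparable_univ_iff.1 (this ▸ hs.closure)

/-- The closed linear span of the vectors `v n`, `n ∈ D`. -/
def famSpan (𝕜 : Type*) [RCLike 𝕜] {X : Type*} [NormedAddCommGroup X] [NormedSpace 𝕜 X]
    (v : ℕ → X) (D : Set ℕ) : Submodule 𝕜 X :=
  (Submodule.span 𝕜 (v '' D)).topologicalClosure

theorem isClosed_famSpan (v : ℕ → X) (D : Set ℕ) : IsClosed (famSpan 𝕜 v D : Set X) :=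
  Submodule.isClosed_topologicalClosure _

theorem isClosed_closedSpan (v : ℕ → X) : IsClosed (closedSpan 𝕜 v : Set X) :=
  Submodule.isClosed_topologicalClosure _

theorem famSpan_univ (v : ℕ → X) : famSpan 𝕜 v Set.univ = closedSpan 𝕜 v := by
  rw [famSpan, closedSpan, Set.image_univ]

theorem mem_famSpan {v : ℕ → X} {D : Set ℕ} {n : ℕ} (hn : n ∈ D) : v n ∈ famSpan 𝕜 v D :=
  Submodule.le_topologicalClosure _ (Submodule.subset_span ⟨n, hn, rfl⟩)

theorem famSpan_le {v : ℕ → X} {D : Set ℕ} {W : Submodule 𝕜 X} (hW : IsClosed (W : Set X))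
    (h : ∀ n ∈ D, v n ∈ W) : famSpan 𝕜 v D ≤ W :=
  Submodule.topologicalClosure_minimal _
    (Submodule.span_le.2 (by rintro _ ⟨n, hn, rfl⟩; exact h n hn)) hW

theorem famSpan_mono {v : ℕ → X} {D D' : Set ℕ} (h : D ⊆ D') :
    famSpan 𝕜 v D ≤ famSpan 𝕜 v D' :=
  famSpan_le (isClosed_famSpan _ _) fun _ hn => mem_famSpan (h hn)

theorem famSpan_congr {v w : ℕ → X} {D D' : Set ℕ} (h : v '' D = w '' D') :
    famSpan 𝕜 v D = famSpan 𝕜 w D' := by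
  rw [famSpan, famSpan, h]

theorem map_mem_of_mem_famSpan {v : ℕ → X} {D : Set ℕ} {W : Submodule 𝕜 X}
    (hW : IsClosed (W : Set X)) (P : X →L[𝕜] X) (h : ∀ n ∈ D, P (v n) ∈ W) {x : X}
    (hx : x ∈ famSpan 𝕜 v D) : P x ∈ W :=
  famSpan_le (W := W.comap P.toLinearMap) (hW.preimage P.continuous) h hx

theorem map_eq_of_mem_famSpan {v : ℕ → X} {D : Set ℕ} {P Q : X →L[𝕜] X}
    (h : ∀ n ∈ D, P (v n) = Q (v n)) {x : X} (hx : x ∈ famSpan 𝕜 v D) : P x = Q x := by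
  have := map_mem_of_mem_famSpan (W := ⊥) (by simp) (P - Q)
    (fun n hn => by simp [h n hn]) hx
  simpa [sub_eq_zero] using this

/-- The vectors of the sequence `v` have pairwise disjoint supports. -/
def IsDisjointlySupported (b : UnconditionalSchauderBasis ℕ 𝕜 X) (v : ℕ → X) : Prop :=
  Pairwise fun m n => Disjoint (coordSupport b (v m)) (coordSupport b (v n))

/-- The union of the supports of the `v n`, `n ∈ D`. -/
def famSupport (b : UnconditionalSchauderBasis ℕ 𝕜 X) (v : ℕ → X) (D : Set ℕ) : Set ℕ :=
  ⋃ n ∈ D, coordSupport b (v n)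

theorem IsDisjointlySupported.coordProj_of_mem [CompleteSpace X]
    {b : UnconditionalSchauderBasis ℕ 𝕜 X} {v : ℕ → X} {D : Set ℕ} {n : ℕ} (hn : n ∈ D) :
    coordProj b (famSupport b v D) (v n) = v n :=
  coordProj_eq_self b (Set.subset_biUnion_of_mem (u := fun n => coordSupport b (v n)) hn)

theorem IsDisjointlySupported.coordProj_of_notMem [CompleteSpace X]
    {b : UnconditionalSchauderBasis ℕ 𝕜 X} {v : ℕ → X} (hv : IsDisjointlySupported b v)
    {D : Set ℕ} {n : ℕ} (hn : n ∉ D) : coordProj b (famSupport b v D) (v n) = 0 := by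
  refine coordProj_eq_zero b (Set.disjoint_iUnion₂_right.2 fun m hm => ?_)
  exact hv (fun h => hn (h ▸ hm))

/-- The projection onto the union of the supports over `D` fixes the terms with index in `D` and
kills the others, so it induces the splitting. -/
theorem IsDisjointlySupported.famSpan_union [CompleteSpace X]
    {b : UnconditionalSchauderBasis ℕ 𝕜 X} {v : ℕ → X} (hv : IsDisjointlySupported b v)
    {D E : Set ℕ} (hDE : Disjoint D E) :
    Nonempty (famSpan 𝕜 v (D ∪ E) ≃L[𝕜] famSpan 𝕜 v D × famSpan 𝕜 v E) := by
  set P := coordProj b (famSupport b v D)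
  have h1 : ∀ x ∈ famSpan 𝕜 v D, P x = x := fun x hx =>
    map_eq_of_mem_famSpan (Q := ContinuousLinearMap.id 𝕜 X)
      (fun n hn => IsDisjointlySupported.coordProj_of_mem hn) hx
  have h2 : ∀ x ∈ famSpan 𝕜 v E, P x = 0 := fun x hx =>
    map_eq_of_mem_famSpan (Q := 0)
      (fun n hn => hv.coordProj_of_notMem (Set.disjoint_right.1 hDE hn)) hx
  have h3 : ∀ x ∈ famSpan 𝕜 v (D ∪ E), P x ∈ famSpan 𝕜 v D := fun x hx =>
    map_mem_of_mem_famSpan (isClosed_famSpan _ _) P (fun n hn => by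
      by_cases hnD : n ∈ D
      · rw [IsDisjointlySupported.coordProj_of_mem hnD]; exact mem_famSpan hnD
      · rw [hv.coordProj_of_notMem hnD]; exact Submodule.zero_mem _) hx
  have h4 : ∀ x ∈ famSpan 𝕜 v (D ∪ E), x - P x ∈ famSpan 𝕜 v E := fun x hx =>
    map_mem_of_mem_famSpan (isClosed_famSpan _ _) (ContinuousLinearMap.id 𝕜 X - P) (fun n hn => by
      by_cases hnD : n ∈ D
      · simp [P, IsDisjointlySupported.coordProj_of_mem hnD]
      · simpa [P, hv.coordProj_of_notMem hnD] using mem_famSpan (hn.resolve_left hnD)) hx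
  refine ⟨ContinuousLinearEquiv.equivOfInverse
    (((P.comp (famSpan 𝕜 v (D ∪ E)).subtypeL).codRestrict _ fun x => h3 x x.2).prod
      (((ContinuousLinearMap.id 𝕜 X - P).comp (famSpan 𝕜 v (D ∪ E)).subtypeL).codRestrict _
        fun x => h4 x x.2))
    ((((famSpan 𝕜 v D).subtypeL.comp (ContinuousLinearMap.fst 𝕜 _ _)) +
      ((famSpan 𝕜 v E).subtypeL.comp (ContinuousLinearMap.snd 𝕜 _ _))).codRestrict _ fun x =>
        Submodule.add_mem _ (famSpan_mono Set.subset_union_left x.1.2)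
          (famSpan_mono Set.subset_union_right x.2.2)) ?_ ?_⟩
  · intro x
    exact Subtype.ext (show P (x : X) + ((x : X) - P x) = x from add_sub_cancel _ _)
  · rintro ⟨x, y⟩
    have hP : P ((x : X) + y) = x := by rw [map_add, h1 x x.2, h2 y y.2, add_zero]
    refine Prod.ext (Subtype.ext hP) (Subtype.ext ?_)
    change ((x : X) + y) - P ((x : X) + y) = y
    rw [hP, add_sub_cancel_left]

theorem IsDisjointlySupported.linearIndependent [CompleteSpace X]
    {b : UnconditionalSchauderBasis ℕ 𝕜 X} {v : ℕ → X} (hv : IsDisjointlySupported b v)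
    (h0 : ∀ n, v n ≠ 0) : LinearIndependent 𝕜 v := by
  classical
  refine linearIndependent_iff.mpr (fun l hl => Finsupp.ext fun n => ?_)
  have h := congrArg (coordProj b (famSupport b v {n})) hl
  rw [Finsupp.linearCombination_apply, Finsupp.sum, map_sum, map_zero,
    Finset.sum_eq_single n] at h
  · rw [map_smul, IsDisjointlySupported.coordProj_of_mem (Set.mem_singleton n)] at h
    simpa [h0 n] using h
  · intro m _ hm
    rw [map_smul, hv.coordProj_of_notMem (by simpa using hm), smul_zero]
  · intro hn
    simp [Finsupp.notMem_support_iff.1 hn]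

theorem famSpan_finset (v : ℕ → X) (A : Finset ℕ) :
    famSpan 𝕜 v A = Submodule.span 𝕜 (v '' A) := by
  have : FiniteDimensional 𝕜 (Submodule.span 𝕜 (v '' (A : Set ℕ))) :=
    FiniteDimensional.span_of_finite 𝕜 (A.finite_toSet.image v)
  exact IsClosed.submodule_topologicalClosure_eq (Submodule.closed_of_finiteDimensional _)

theorem finrank_famSpan_finset {v : ℕ → X} (hv : LinearIndependent 𝕜 v) (A : Finset ℕ) :
    FiniteDimensional 𝕜 (famSpan 𝕜 v A) ∧ Module.finrank 𝕜 (famSpan 𝕜 v A) = A.card := by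
  rw [famSpan_finset]
  refine ⟨FiniteDimensional.span_of_finite 𝕜 (A.finite_toSet.image v), ?_⟩
  rw [Set.image_eq_range, finrank_span_eq_card]
  · exact Fintype.card_coe A
  · exact hv.comp (fun i : A ↦ i.val) Subtype.val_injective

theorem famSpan_finset_equiv {v w : ℕ → X} (hv : LinearIndependent 𝕜 v)
    (hw : LinearIndependent 𝕜 w) {A B : Finset ℕ} (h : A.card = B.card) :
    Nonempty (famSpan 𝕜 v A ≃L[𝕜] famSpan 𝕜 w B) := by
  obtain ⟨_, hA⟩ := finrank_famSpan_finset hv A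
  obtain ⟨_, hB⟩ := finrank_famSpan_finset hw B
  exact ⟨ContinuousLinearEquiv.ofFinrankEq (by rw [hA, hB, h])⟩

/-- Replacing finitely many terms by the same number of other terms does not change the
isomorphism class. -/
theorem famSpan_equiv_of_finite_change [CompleteSpace X]
    {b : UnconditionalSchauderBasis ℕ 𝕜 X} {v w : ℕ → X} (hv : IsDisjointlySupported b v)
    (hv0 : ∀ n, v n ≠ 0) (hw : IsDisjointlySupported b w) (hw0 : ∀ n, w n ≠ 0)
    {A B : Finset ℕ} {D E : Set ℕ} (hAD : Disjoint (A : Set ℕ) D) (hBE : Disjoint (B : Set ℕ) E)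
    (hcard : A.card = B.card) (himg : v '' D = w '' E) :
    Nonempty (famSpan 𝕜 v (A ∪ D) ≃L[𝕜] famSpan 𝕜 w (B ∪ E)) := by
  obtain ⟨f⟩ := hv.famSpan_union hAD
  obtain ⟨g⟩ := hw.famSpan_union hBE
  obtain ⟨k⟩ := famSpan_finset_equiv (hv.linearIndependent hv0) (hw.linearIndependent hw0) hcard
  rw [famSpan_congr himg] at f
  exact ⟨(f.trans (k.prodCongr (ContinuousLinearEquiv.refl 𝕜 _))).trans g.symm⟩

/-- A finite `D` spans a space of dimension its cardinality, whereas one more vector of `w` already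
exceeds that dimension. -/
theorem infinite_of_famSpan_equiv {v w : ℕ → X} (hv : LinearIndependent 𝕜 v)
    (hw : LinearIndependent 𝕜 w) {D : Set ℕ}
    (h : Nonempty (famSpan 𝕜 v D ≃L[𝕜] closedSpan 𝕜 w)) : D.Infinite := by
  intro hD
  obtain ⟨f⟩ := h
  obtain ⟨_, hr⟩ := finrank_famSpan_finset hv hD.toFinset
  rw [hD.coe_toFinset] at *
  have : FiniteDimensional 𝕜 (closedSpan 𝕜 w) := f.toLinearEquiv.finiteDimensional
  have hle : famSpan 𝕜 w (Finset.range (hD.toFinset.card + 1)) ≤ closedSpan 𝕜 w := by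
    rw [← famSpan_univ]; exact famSpan_mono (Set.subset_univ _)
  have := Submodule.finrank_mono hle
  rw [(finrank_famSpan_finset hw _).2, ← f.toLinearEquiv.finrank_eq, hr] at this
  simp at this

/-- The components of `x` are its projections onto the supports of the families. Their sum is the
unconditional basis expansion of `x`, regrouped. -/
theorem IsDisjointlySupported.isUnconditionalDirectSum [CompleteSpace X]
    {b : UnconditionalSchauderBasis ℕ 𝕜 X} {v : ℕ → X} (hv : IsDisjointlySupported b v)
    {ι : Type*} {D : ι → Set ℕ} (hD : Pairwise fun i j => Disjoint (D i) (D j)) :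
    IsUnconditionalDirectSum (fun i => famSpan 𝕜 v (D i)) (famSpan 𝕜 v (⋃ i, D i)) := by
  classical
  refine ⟨isClosed_famSpan _ _, fun i => isClosed_famSpan _ _,
    fun i => famSpan_mono (Set.subset_iUnion _ _), fun x hx => ?_⟩
  have hself : ∀ i, ∀ y ∈ famSpan 𝕜 v (D i), coordProj b (famSupport b v (D i)) y = y :=
    fun i y hy => map_eq_of_mem_famSpan (Q := ContinuousLinearMap.id 𝕜 X)
      (fun n hn => IsDisjointlySupported.coordProj_of_mem hn) hy
  have hzero : ∀ i j, j ≠ i → ∀ y ∈ famSpan 𝕜 v (D j),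
      coordProj b (famSupport b v (D i)) y = 0 :=
    fun i j hij y hy => map_eq_of_mem_famSpan (Q := 0)
      (fun n hn => hv.coordProj_of_notMem (Set.disjoint_left.1 (hD hij) hn)) hy
  refine ⟨fun i => coordProj b (famSupport b v (D i)) x, ⟨fun i => ?_, ?_⟩, ?_⟩
  · refine map_mem_of_mem_famSpan (isClosed_famSpan _ _) _ (fun n hn => ?_) hx
    by_cases hnD : n ∈ D i
    · rw [IsDisjointlySupported.coordProj_of_mem hnD]; exact mem_famSpan hnD
    · rw [hv.coordProj_of_notMem hnD]; exact Submodule.zero_mem _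
  · set U := famSupport b v (⋃ i, D i)
    have hxU : coordProj b U x = x := map_eq_of_mem_famSpan (Q := ContinuousLinearMap.id 𝕜 X)
      (fun n hn => IsDisjointlySupported.coordProj_of_mem hn) hx
    have hU : ∀ k ∈ U, ∃ i, k ∈ famSupport b v (D i) := by
      intro k hk
      obtain ⟨n, hn, hk⟩ := Set.mem_iUnion₂.1 hk
      obtain ⟨i, hi⟩ := Set.mem_iUnion.1 hn
      exact ⟨i, Set.mem_iUnion₂.2 ⟨n, hi, hk⟩⟩
    have hU' : ∀ i, famSupport b v (D i) ⊆ U := fun i =>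
      Set.biUnion_subset_biUnion_left (Set.subset_iUnion _ _)
    have hdisj : ∀ i j, i ≠ j → Disjoint (famSupport b v (D i)) (famSupport b v (D j)) := by
      intro i j hij
      refine Set.disjoint_iUnion₂_left.2 fun m hm => Set.disjoint_iUnion₂_right.2 fun n hn => ?_
      exact hv fun hmn => Set.disjoint_left.1 (hD hij) hm (hmn ▸ hn)
    -- The disjoint supports are indexed by a sigma type, so that summing over each fibre regroups
    -- the expansion.
    let s : (Σ i, famSupport b v (D i)) → ℕ := fun p => p.2
    have hs : Function.Injective s := by
      rintro ⟨i, k, hk⟩ ⟨j, l, hl⟩ (rfl : k = l)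
      have : i = j := by
        by_contra hij
        exact Set.disjoint_left.1 (hdisj i j hij) hk hl
      subst this
      rfl
    have h1 := hasSum_coordProj b U x
    rw [hxU, ← hs.hasSum_iff] at h1
    · refine h1.sigma fun i => ?_
      have h2 := (hasSum_subtype_iff_indicator (s := famSupport b v (D i))).2
        (hasSum_coordProj b (famSupport b v (D i)) x)
      convert h2 using 2 with k
      exact Set.indicator_of_mem (hU' i k.2) _
    · intro k hk
      refine Set.indicator_of_notMem (fun hkU => hk ?_) _
      obtain ⟨i, hi⟩ := hU k hkU
      exact ⟨⟨i, k, hi⟩, rfl⟩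
  -- Uniqueness: the `i`-th projection kills every term of the series but `f i`.
  · rintro f ⟨hf, hsum⟩
    funext i
    refine HasSum.unique ?_ (hsum.mapL (coordProj b (famSupport b v (D i))))
    convert hasSum_ite_eq i (f i) using 2 with j
    by_cases hji : j = i
    · subst hji; simp [hself j _ (hf j)]
    · simp [hji, hzero i j hji _ (hf j)]

end UnconditionalBases

/-! ### Descriptive complexity of isomorphism and the zero-one law -/

section Classes

variable {𝕜 : Type*} [RCLike 𝕜] {X : Type*} [NormedAddCommGroup X] [NormedSpace 𝕜 X]

theorem SubspaceIso.refl (V : Submodule 𝕜 X) : SubspaceIso 𝕜 V V :=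
  ⟨ContinuousLinearEquiv.refl _ _⟩

theorem SubspaceIso.symm {V W : Submodule 𝕜 X} (h : SubspaceIso 𝕜 V W) : SubspaceIso 𝕜 W V :=
  h.map ContinuousLinearEquiv.symm

theorem SubspaceIso.trans {U V W : Submodule 𝕜 X} (h : SubspaceIso 𝕜 U V)
    (h' : SubspaceIso 𝕜 V W) : SubspaceIso 𝕜 U W := by
  obtain ⟨f⟩ := h
  obtain ⟨g⟩ := h'
  exact ⟨f.trans g⟩

/-- The map sending finitely supported coefficients to the combination of the terms of `f`, with
values in the closed span. -/
noncomputable def combinationInClosedSpan (𝕜 : Type*) [RCLike 𝕜] {X : Type*}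
    [NormedAddCommGroup X] [NormedSpace 𝕜 X] (f : ℕ → X) : (ℕ →₀ 𝕜) →ₗ[𝕜] closedSpan 𝕜 f :=
  (Finsupp.linearCombination 𝕜 f).codRestrict _ fun l =>
    Submodule.le_topologicalClosure _
      (Finsupp.range_linearCombination 𝕜 (v := f) ▸ LinearMap.mem_range_self _ l)

@[simp]
theorem coe_combinationInClosedSpan (f : ℕ → X) (l : ℕ →₀ 𝕜) :
    (combinationInClosedSpan 𝕜 f l : X) = Finsupp.linearCombination 𝕜 f l :=
  rfl

theorem denseRange_combinationInClosedSpan (f : ℕ → X) :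
    DenseRange (combinationInClosedSpan 𝕜 f) := by
  intro x
  rw [closure_subtype]
  have hx : (x : X) ∈ closure (Submodule.span 𝕜 (Set.range f) : Set X) := x.2
  convert hx using 2
  rw [← Finsupp.range_linearCombination]
  ext y
  constructor
  · rintro ⟨_, ⟨l, rfl⟩, rfl⟩
    exact ⟨l, rfl⟩
  · rintro ⟨l, rfl⟩
    exact ⟨_, ⟨l, rfl⟩, rfl⟩

theorem subspaceIso_closedSpan_of_equivalent [CompleteSpace X] {f g : ℕ → X} {K : ℝ}
    (h : ∀ l : ℕ →₀ 𝕜,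
      ‖Finsupp.linearCombination 𝕜 g l‖ ≤ K * ‖Finsupp.linearCombination 𝕜 f l‖ ∧
      ‖Finsupp.linearCombination 𝕜 f l‖ ≤ K * ‖Finsupp.linearCombination 𝕜 g l‖) :
    SubspaceIso 𝕜 (closedSpan 𝕜 f) (closedSpan 𝕜 g) := by
  have : CompleteSpace (closedSpan 𝕜 f) := (isClosed_closedSpan f).completeSpace_coe
  have : CompleteSpace (closedSpan 𝕜 g) := (isClosed_closedSpan g).completeSpace_coe
  exact ⟨(LinearEquiv.refl 𝕜 (ℕ →₀ 𝕜)).extend (combinationInClosedSpan 𝕜 f)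
    (combinationInClosedSpan 𝕜 g) (denseRange_combinationInClosedSpan f) ⟨K, fun l => (h l).1⟩
    (denseRange_combinationInClosedSpan g) ⟨K, fun l => (h l).2⟩⟩

theorem closedSpan_eq_of_equiv {f : ℕ → X} {V : Submodule 𝕜 X} (hV : IsClosed (V : Set X))
    (φ : closedSpan 𝕜 f ≃L[𝕜] V) (hmem : ∀ n, f n ∈ closedSpan 𝕜 f) :
    closedSpan 𝕜 (fun n => (φ ⟨f n, hmem n⟩ : X)) = V := by
  refine le_antisymm (Submodule.topologicalClosure_minimal _ (Submodule.span_le.2 ?_) hV) ?_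
  · rintro _ ⟨n, rfl⟩
    exact (φ _).2
  · intro y hy
    obtain ⟨x, hx⟩ := φ.surjective ⟨y, hy⟩
    set g : ℕ → X := fun n => (φ ⟨f n, hmem n⟩ : X)
    have key : ∀ x : closedSpan 𝕜 f, (φ x : X) ∈ closedSpan 𝕜 g := by
      intro x
      refine (denseRange_combinationInClosedSpan f).induction_on
        (p := fun x => (φ x : X) ∈ closedSpan 𝕜 g) x ?_ ?_
      · exact (isClosed_closedSpan g).preimage (continuous_subtype_val.comp φ.continuous)
      · intro l
        have : (φ (combinationInClosedSpan 𝕜 f l) : X) = combinationInClosedSpan 𝕜 g l := by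
          have h2 : (V.subtype ∘ₗ φ.toLinearEquiv.toLinearMap) ∘ₗ combinationInClosedSpan 𝕜 f
              = (closedSpan 𝕜 g).subtype ∘ₗ combinationInClosedSpan 𝕜 g := by
            ext n
            have e1 : combinationInClosedSpan 𝕜 f (Finsupp.single n 1) = ⟨f n, hmem n⟩ :=
              Subtype.ext (by simp)
            have e2 : (combinationInClosedSpan 𝕜 g (Finsupp.single n 1) : X) = g n := by simp
            simp [e1, e2, g]
          exact LinearMap.congr_fun h2 l
        rw [this]
        exact (combinationInClosedSpan 𝕜 g l).2
    have := key x
    rwa [hx] at this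

theorem mem_closedSpan (f : ℕ → X) (n : ℕ) : f n ∈ closedSpan 𝕜 f :=
  Submodule.le_topologicalClosure _ (Submodule.subset_span ⟨n, rfl⟩)

/-- Rewrites isomorphism as the existence of an equivalent sequence `g` generating `V`, which
exhibits the class as a projection. The integer constant `K` keeps the union over constants
countable. -/
theorem subspaceIso_closedSpan_iff [CompleteSpace X] {f : ℕ → X} {V : Submodule 𝕜 X}
    (hV : IsClosed (V : Set X)) :
    SubspaceIso 𝕜 (closedSpan 𝕜 f) V ↔ ∃ g : ℕ → X, ∃ K : ℕ, (∀ l : ℕ →₀ 𝕜,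
      ‖Finsupp.linearCombination 𝕜 g l‖ ≤ K * ‖Finsupp.linearCombination 𝕜 f l‖ ∧
      ‖Finsupp.linearCombination 𝕜 f l‖ ≤ K * ‖Finsupp.linearCombination 𝕜 g l‖) ∧
      closedSpan 𝕜 g = V := by
  constructor
  · rintro ⟨φ⟩
    obtain ⟨K, hK⟩ := exists_nat_ge
      (max ‖(φ : closedSpan 𝕜 f →L[𝕜] V)‖ ‖(φ.symm : V →L[𝕜] closedSpan 𝕜 f)‖)
    refine ⟨fun n => (φ ⟨f n, mem_closedSpan f n⟩ : X), K, fun l => ?_,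
      closedSpan_eq_of_equiv hV φ _⟩
    have h : (V.subtype ∘ₗ φ.toLinearEquiv.toLinearMap) ∘ₗ combinationInClosedSpan 𝕜 f
        = Finsupp.linearCombination 𝕜 (fun n => (φ ⟨f n, mem_closedSpan f n⟩ : X)) := by
      ext n
      have e1 : combinationInClosedSpan 𝕜 f (Finsupp.single n 1) = ⟨f n, mem_closedSpan f n⟩ :=
        Subtype.ext (by simp)
      simp [e1]
    rw [← h]
    change ‖φ (combinationInClosedSpan 𝕜 f l)‖ ≤ K * ‖combinationInClosedSpan 𝕜 f l‖ ∧
      ‖combinationInClosedSpan 𝕜 f l‖ ≤ K * ‖φ (combinationInClosedSpan 𝕜 f l)‖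
    constructor
    · exact ((φ : closedSpan 𝕜 f →L[𝕜] V).le_opNorm _).trans
        (mul_le_mul_of_nonneg_right ((le_max_left _ _).trans hK) (norm_nonneg _))
    · have := (φ.symm : V →L[𝕜] closedSpan 𝕜 f).le_opNorm (φ (combinationInClosedSpan 𝕜 f l))
      simp only [ContinuousLinearEquiv.coe_coe, ContinuousLinearEquiv.symm_apply_apply] at this
      exact this.trans
        (mul_le_mul_of_nonneg_right ((le_max_right _ _).trans hK) (norm_nonneg _))
  · rintro ⟨g, K, h, rfl⟩
    exact subspaceIso_closedSpan_of_equivalent h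

theorem measurableSet_closedSpan_eq [TopologicalSpace.SeparableSpace X] {V : Submodule 𝕜 X}
    (hV : IsClosed (V : Set X)) :
    @MeasurableSet _ (borel (ℕ → X)) {g : ℕ → X | closedSpan 𝕜 g = V} := by
  borelize (ℕ → X)
  have : TopologicalSpace.SeparableSpace V := by
    have := UniformSpace.secondCountable_of_separable X
    infer_instance
  let d := TopologicalSpace.denseSeq V
  -- Containment in `V` is a closed condition on `g`. Containment of `V` is tested on a dense
  -- sequence with tolerances `1 / (k + 1)`, which is a Gδ condition.
  have heq : {g : ℕ → X | closedSpan 𝕜 g = V} = {g | ∀ n, g n ∈ V} ∩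
      ⋂ j : ℕ, ⋂ k : ℕ, ⋃ l : ℕ →₀ 𝕜,
        {g | ‖(d j : X) - Finsupp.linearCombination 𝕜 g l‖ < 1 / ((k : ℝ) + 1)} := by
    ext g
    simp only [Set.mem_ofPred_eq, Set.mem_inter_iff, Set.mem_iInter, Set.mem_iUnion]
    constructor
    · rintro rfl
      refine ⟨mem_closedSpan g, fun j k => ?_⟩
      obtain ⟨_, ⟨l, rfl⟩, hl⟩ := Metric.mem_closure_iff.1
        (denseRange_combinationInClosedSpan g (d j)) (1 / ((k : ℝ) + 1)) Nat.one_div_pos_of_nat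
      exact ⟨l, by simpa [dist_eq_norm] using hl⟩
    · rintro ⟨h1, h2⟩
      refine le_antisymm (Submodule.topologicalClosure_minimal _ (Submodule.span_le.2 ?_) hV) ?_
      · rintro _ ⟨n, rfl⟩
        exact h1 n
      · intro y hy
        have hd : ∀ j, (d j : X) ∈ closedSpan 𝕜 g := by
          intro j
          refine Metric.mem_closure_iff.2 fun ε hε => ?_
          obtain ⟨k, hk⟩ := exists_nat_one_div_lt hε
          obtain ⟨l, hl⟩ := h2 j k
          exact ⟨_, Finsupp.range_linearCombination 𝕜 (v := g) ▸ LinearMap.mem_range_self _ l,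
            by rw [dist_eq_norm]; exact hl.trans hk⟩
        exact (TopologicalSpace.denseRange_denseSeq V).induction_on
          (p := fun x : V => (x : X) ∈ closedSpan 𝕜 g) ⟨y, hy⟩
          ((isClosed_closedSpan g).preimage continuous_subtype_val) hd
  rw [heq]
  have hc : ∀ l : ℕ →₀ 𝕜, Continuous fun g : ℕ → X => Finsupp.linearCombination 𝕜 g l := by
    intro l
    simp only [Finsupp.linearCombination_apply, Finsupp.sum]
    fun_prop
  refine MeasurableSet.inter ?_ (MeasurableSet.iInter fun j => MeasurableSet.iInter fun k =>
    IsOpen.measurableSet (isOpen_iUnion fun l => ?_))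
  · rw [Set.ofPred_forall]
    exact (isClosed_iInter fun n => hV.preimage (continuous_apply n)).measurableSet
  · exact isOpen_lt (by have := hc l; fun_prop) continuous_const

/-- For each constant `K`, the equivalent generating sequences form a Borel set in a Polish product,
which is then projected to `T`. -/
theorem analyticSet_subspaceIso [CompleteSpace X] [TopologicalSpace.SeparableSpace X]
    {T : Type*} [TopologicalSpace T] [PolishSpace T] {f : T → ℕ → X} (hf : Continuous f)
    {V : Submodule 𝕜 X} (hV : IsClosed (V : Set X)) :
    MeasureTheory.AnalyticSet {t | SubspaceIso 𝕜 (closedSpan 𝕜 (f t)) V} := by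
  have := UniformSpace.secondCountable_of_separable X
  have heq : {t | SubspaceIso 𝕜 (closedSpan 𝕜 (f t)) V} = ⋃ K : ℕ, Prod.fst ''
      ({p : T × (ℕ → X) | ∀ l : ℕ →₀ 𝕜,
        ‖Finsupp.linearCombination 𝕜 p.2 l‖ ≤ K * ‖Finsupp.linearCombination 𝕜 (f p.1) l‖ ∧
        ‖Finsupp.linearCombination 𝕜 (f p.1) l‖ ≤ K * ‖Finsupp.linearCombination 𝕜 p.2 l‖} ∩
      {p | closedSpan 𝕜 p.2 = V}) := by
    ext t
    rw [Set.mem_ofPred_eq, subspaceIso_closedSpan_iff hV, Set.mem_iUnion]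
    constructor
    · rintro ⟨g, K, h1, h2⟩
      exact ⟨K, (t, g), ⟨h1, h2⟩, rfl⟩
    · rintro ⟨K, ⟨_, g⟩, ⟨h1, h2⟩, rfl⟩
      exact ⟨g, K, h1, h2⟩
  rw [heq]
  refine MeasureTheory.AnalyticSet.iUnion fun K => ?_
  refine MeasureTheory.AnalyticSet.image_of_continuous ?_ continuous_fst
  borelize (T × (ℕ → X))
  borelize (ℕ → X)
  refine MeasurableSet.analyticSet (MeasurableSet.inter ?_ ?_)
  · have hc : ∀ l : ℕ →₀ 𝕜, Continuous fun g : ℕ → X => Finsupp.linearCombination 𝕜 g l := by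
      intro l
      simp only [Finsupp.linearCombination_apply, Finsupp.sum]
      fun_prop
    rw [Set.ofPred_forall]
    refine (isClosed_iInter fun l => ?_).measurableSet
    have h1 := (hc l).comp (continuous_snd (X := T) (Y := ℕ → X))
    have h2 := (hc l).comp (hf.comp (continuous_fst (X := T) (Y := ℕ → X)))
    exact (isClosed_le h1.norm (continuous_const.mul h2.norm)).inter
      (isClosed_le h2.norm (continuous_const.mul h1.norm))
  · have hm : Measurable (Prod.snd : T × (ℕ → X) → ℕ → X) := continuous_snd.measurable
    exact hm (t := {g | closedSpan 𝕜 g = V}) (by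
      rw [BorelSpace.measurable_eq (α := ℕ → X)]; exact measurableSet_closedSpan_eq hV)

/-- A topological zero-one law for isomorphism classes of closed spans. -/
theorem exists_residual_class [CompleteSpace X] [TopologicalSpace.SeparableSpace X]
    (hcount : IsCountablyHomogeneous 𝕜 X)
    {T : Type*} [TopologicalSpace T] [PolishSpace T] [Nonempty T] {f : T → ℕ → X}
    (hf : Continuous f)
    (htrans : ∀ U V : Set T, IsOpen U → IsOpen V → U.Nonempty → V.Nonempty →
      ∃ h : T ≃ₜ T, (∀ t, SubspaceIso 𝕜 (closedSpan 𝕜 (f (h t))) (closedSpan 𝕜 (f t))) ∧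
        ∃ t ∈ U, h t ∈ V) :
    ∃ t₀, {t | SubspaceIso 𝕜 (closedSpan 𝕜 (f t)) (closedSpan 𝕜 (f t₀))} ∈ residual T := by
  obtain ⟨W, hW⟩ := hcount
  let A : ℕ → Set T := fun n =>
    {t | IsClosed (W n : Set X) ∧ SubspaceIso 𝕜 (closedSpan 𝕜 (f t)) (W n)}
  have hA : ⋃ n, A n = Set.univ :=
    Set.eq_univ_of_forall fun t => Set.mem_iUnion.2 (hW _ (isClosed_closedSpan (f t)))
  obtain ⟨n, hn⟩ : ∃ n, ¬ IsMeagre (A n) := by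
    by_contra! h
    exact not_isMeagre_of_isOpen (isOpen_univ (X := T)) Set.univ_nonempty
      (hA ▸ isMeagre_iUnion h)
  obtain ⟨t₀, hc, ht₀⟩ : (A n).Nonempty := by
    rw [Set.nonempty_iff_ne_empty]
    intro h
    exact hn (h ▸ IsMeagre.empty)
  refine ⟨t₀, ?_⟩
  set B := {t | SubspaceIso 𝕜 (closedSpan 𝕜 (f t)) (closedSpan 𝕜 (f t₀))}
  have hBA : B = A n := by
    ext t
    exact ⟨fun h => ⟨hc, h.trans ht₀⟩, fun h => h.2.trans ht₀.symm⟩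
  borelize T
  -- Suslin's theorem: the complement is a countable union of classes, hence analytic too.
  have hBm : MeasurableSet B := by
    refine (analyticSet_subspaceIso hf (isClosed_closedSpan _)).measurableSet_of_compl ?_
    have : Bᶜ = ⋃ m : {m // IsClosed (W m : Set X) ∧
        ¬ SubspaceIso 𝕜 (closedSpan 𝕜 (f t₀)) (W m)},
        {t | SubspaceIso 𝕜 (closedSpan 𝕜 (f t)) (W m)} := by
      ext t
      simp only [Set.mem_compl_iff, Set.mem_iUnion, Set.mem_ofPred_eq]
      constructor
      · intro h
        obtain ⟨m, hm, hm'⟩ := hW _ (isClosed_closedSpan (f t))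
        exact ⟨⟨m, hm, fun h' => h (hm'.trans h'.symm)⟩, hm'⟩
      · rintro ⟨⟨m, hm, hm'⟩, h⟩ h'
        exact hm' (h'.symm.trans h)
    rw [this]
    exact MeasureTheory.AnalyticSet.iUnion fun m => analyticSet_subspaceIso hf m.2.1
  obtain ⟨O, hO, hBO⟩ := hBm.residualEq_isOpen
  have hOne : O.Nonempty := by
    rw [Set.nonempty_iff_ne_empty]
    rintro rfl
    refine hn (hBA ▸ ?_)
    filter_upwards [hBO.mem_iff] with t ht
    exact fun h => (ht.1 h)
  -- Otherwise `h` carries a nonempty open part of `O`, where `B` is comeagre, into the exterior of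
  -- `O`, where `B` is meagre. This is absurd, since `h` preserves both `B` and category.
  have hdense : Dense O := by
    by_contra hd
    have hVne : (closure O)ᶜ.Nonempty := by
      rw [Set.nonempty_compl]
      exact fun h => hd (dense_iff_closure_eq.2 h)
    obtain ⟨h, hh, t, htO, htV⟩ := htrans O (closure O)ᶜ hO isClosed_closure.isOpen_compl hOne hVne
    have hP : IsOpen (O ∩ h ⁻¹' (closure O)ᶜ) :=
      hO.inter (isClosed_closure.isOpen_compl.preimage h.continuous)
    refine not_isMeagre_of_isOpen hP ⟨t, htO, htV⟩ ?_
    filter_upwards [hBO.mem_iff,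
      (tendsto_residual_of_isOpenMap h.continuous h.isOpenMap).eventually hBO.mem_iff]
      with s hs hs' hsP
    exact hsP.2 (subset_closure (hs'.1 ((hh s).trans (hs.2 hsP.1))))
  filter_upwards [hBO.mem_iff, residual_of_dense_open hO hdense] with t ht htO
  exact ht.2 htO

end Classes

/-! ### Homeomorphisms that exchange prefixes -/

section Prefixes

theorem polishSpace_of_countable_discrete (Q : Type*) [TopologicalSpace Q] [DiscreteTopology Q]
    [Countable Q] : PolishSpace Q := by
  obtain ⟨f, hf⟩ := exists_injective_nat Q
  exact (IsClosedEmbedding.of_continuous_injective_isClosedMap continuous_of_discreteTopology hf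
    fun s _ => isClosed_discrete _).polishSpace

variable {Q T : Type*} [TopologicalSpace Q] [DiscreteTopology Q] [TopologicalSpace T]

theorem exists_cylinder_subset {ι : T → ℕ → Q} (hι : IsInducing ι) {U : Set T} (hU : IsOpen U)
    {x : T} (hx : x ∈ U) : ∃ l, ∀ y, (∀ i < l, ι y i = ι x i) → y ∈ U := by
  obtain ⟨V, hV, rfl⟩ := hι.isOpen_iff.1 hU
  obtain ⟨_, ⟨z, l, rfl⟩, hz, hsub⟩ :=
    (PiNat.isTopologicalBasis_cylinders fun _ : ℕ => Q).exists_subset_of_mem_open hx hV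
  refine ⟨l, fun y hy => hsub ?_⟩
  rw [PiNat.mem_cylinder_iff] at hz ⊢
  exact fun i hi => (hy i hi).trans (hz i hi)

theorem isOpen_setOf_prefix {ι : T → ℕ → Q} (hι : Continuous ι) (x : ℕ → Q) (l : ℕ) :
    IsOpen {y | ∀ i < l, ι y i = x i} := by
  convert (PiNat.isOpen_cylinder (fun _ : ℕ => Q) x l).preimage hι using 1
  ext y
  simp [PiNat.mem_cylinder_iff]

theorem continuous_of_prefix {ι : T → ℕ → Q} (hι : IsInducing ι) {h : T → T}
    (H : ∀ n, ∃ N, ∀ z z', (∀ i < N, ι z i = ι z' i) → ι (h z) n = ι (h z') n) :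
    Continuous h := by
  refine hι.continuous_iff.2 (continuous_pi fun n => IsLocallyConstant.continuous ?_)
  refine (IsLocallyConstant.iff_exists_open _).2 fun z => ?_
  obtain ⟨N, hN⟩ := H n
  exact ⟨_, isOpen_setOf_prefix hι.continuous (ι z) N, fun _ _ => rfl,
    fun z' hz' => hN z' z hz'⟩

/-- Every sequence of `T` with the prefix of length `l` of `x` can be given the prefix of `y`
instead, within its `r`-class. -/
def PrefixReplaceable (ι : T → ℕ → Q) (r : T → T → Prop) (l : ℕ) (x y : T) : Prop :=
  ∀ z, (∀ i < l, ι z i = ι x i) →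
    ∃ w, (∀ i < l, ι w i = ι y i) ∧ (∀ i, l ≤ i → ι w i = ι z i) ∧ r w z

/-- Exchanging the two prefixes and fixing everything else is an involution: distinct prefixes of
equal length define disjoint cylinders. It is continuous because each output term depends on
finitely many input terms. -/
theorem exists_prefix_swap {ι : T → ℕ → Q} (hι : IsInducing ι) (hinj : Function.Injective ι)
    {r : T → T → Prop} (hr : ∀ t, r t t) {l : ℕ} {x y : T}
    (hxy : PrefixReplaceable ι r l x y) (hyx : PrefixReplaceable ι r l y x) :
    ∃ h : T ≃ₜ T, (∀ t, r (h t) t) ∧ ∀ i < l, ι (h x) i = ι y i := by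
  classical
  by_cases hne : ∀ i < l, ι x i = ι y i
  · exact ⟨Homeomorph.refl T, hr, hne⟩
  choose! f hf1 hf2 hf3 using hxy
  choose! g hg1 hg2 hg3 using hyx
  have hdisj : ∀ z, (∀ i < l, ι z i = ι x i) → ¬ ∀ i < l, ι z i = ι y i :=
    fun z h h' => hne fun i hi => (h i hi).symm.trans (h' i hi)
  let h : T → T := fun z => if ∀ i < l, ι z i = ι x i then f z
    else if ∀ i < l, ι z i = ι y i then g z else z
  have hhx : ∀ z, (∀ i < l, ι z i = ι x i) → h z = f z := fun z hz => if_pos hz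
  have hhy : ∀ z, (∀ i < l, ι z i = ι y i) → h z = g z := fun z hz => by
    change ite _ _ _ = _
    rw [if_neg (fun h' => hdisj z h' hz), if_pos hz]
  have hh0 : ∀ z, (¬ ∀ i < l, ι z i = ι x i) → (¬ ∀ i < l, ι z i = ι y i) → h z = z :=
    fun z hz hz' => by
      change ite _ _ _ = _
      rw [if_neg hz, if_neg hz']
  have hinv : Function.Involutive h := by
    intro z
    by_cases hz : ∀ i < l, ι z i = ι x i
    · rw [hhx z hz, hhy _ (hf1 z hz)]
      refine hinj (funext fun i => ?_)
      rcases lt_or_ge i l with hi | hi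
      · rw [hg1 _ (hf1 z hz) i hi, hz i hi]
      · rw [hg2 _ (hf1 z hz) i hi, hf2 z hz i hi]
    · by_cases hz' : ∀ i < l, ι z i = ι y i
      · rw [hhy z hz', hhx _ (hg1 z hz')]
        refine hinj (funext fun i => ?_)
        rcases lt_or_ge i l with hi | hi
        · rw [hf1 _ (hg1 z hz') i hi, hz' i hi]
        · rw [hf2 _ (hg1 z hz') i hi, hg2 z hz' i hi]
      · rw [hh0 z hz hz', hh0 z hz hz']
  have hcont : Continuous h := by
    refine continuous_of_prefix hι fun n => ⟨max l (n + 1), fun z z' hzz' => ?_⟩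
    have hl : ∀ i < l, ι z i = ι z' i := fun i hi => hzz' i (lt_max_of_lt_left hi)
    have hn : ι z n = ι z' n := hzz' n (lt_max_of_lt_right n.lt_succ_self)
    by_cases hz : ∀ i < l, ι z i = ι x i
    · have hz2 : ∀ i < l, ι z' i = ι x i := fun i hi => (hl i hi).symm.trans (hz i hi)
      rw [hhx z hz, hhx z' hz2]
      rcases lt_or_ge n l with hi | hi
      · rw [hf1 z hz n hi, hf1 z' hz2 n hi]
      · rw [hf2 z hz n hi, hf2 z' hz2 n hi, hn]
    · have hz2 : ¬ ∀ i < l, ι z' i = ι x i := fun H => hz fun i hi => (hl i hi).trans (H i hi)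
      by_cases hz' : ∀ i < l, ι z i = ι y i
      · have hz3 : ∀ i < l, ι z' i = ι y i := fun i hi => (hl i hi).symm.trans (hz' i hi)
        rw [hhy z hz', hhy z' hz3]
        rcases lt_or_ge n l with hi | hi
        · rw [hg1 z hz' n hi, hg1 z' hz3 n hi]
        · rw [hg2 z hz' n hi, hg2 z' hz3 n hi, hn]
      · have hz3 : ¬ ∀ i < l, ι z' i = ι y i :=
          fun H => hz' fun i hi => (hl i hi).trans (H i hi)
        rw [hh0 z hz hz', hh0 z' hz2 hz3, hn]
  refine ⟨⟨hinv.toPerm h, hcont, hcont⟩, fun t => ?_, fun i hi => ?_⟩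
  · change r (h t) t
    by_cases hz : ∀ i < l, ι t i = ι x i
    · rw [hhx t hz]; exact hf3 t hz
    · by_cases hz' : ∀ i < l, ι t i = ι y i
      · rw [hhy t hz']; exact hg3 t hz'
      · rw [hh0 t hz hz']; exact hr t
  · change ι (h x) i = ι y i
    rw [hhx x fun _ _ => rfl]
    exact hf1 x (fun _ _ => rfl) i hi

/-- Provides the transitivity needed by the zero-one law: prefixes that determine `U` and `V` are
first lengthened until they become exchangeable. -/
theorem exists_homeomorph_of_prefixReplaceable {ι : T → ℕ → Q} (hι : IsInducing ι)
    (hinj : Function.Injective ι) {r : T → T → Prop} (hr : ∀ t, r t t)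
    (H : ∀ x y l, ∃ x' y' l', l ≤ l' ∧ (∀ i < l, ι x' i = ι x i) ∧ (∀ i < l, ι y' i = ι y i) ∧
      PrefixReplaceable ι r l' x' y' ∧ PrefixReplaceable ι r l' y' x')
    {U V : Set T} (hU : IsOpen U) (hV : IsOpen V) (hUne : U.Nonempty) (hVne : V.Nonempty) :
    ∃ h : T ≃ₜ T, (∀ t, r (h t) t) ∧ ∃ t ∈ U, h t ∈ V := by
  obtain ⟨x, hx⟩ := hUne
  obtain ⟨y, hy⟩ := hVne
  obtain ⟨m, hm⟩ := exists_cylinder_subset hι hU hx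
  obtain ⟨n, hn⟩ := exists_cylinder_subset hι hV hy
  obtain ⟨x', y', l, hl, hx', hy', h1, h2⟩ := H x y (max m n)
  obtain ⟨h, hh, hhx⟩ := exists_prefix_swap hι hinj hr h1 h2
  refine ⟨h, hh, x', hm _ fun i hi => hx' i (lt_max_of_lt_left hi), hn _ fun i hi => ?_⟩
  have hi' : i < max m n := lt_max_of_lt_right hi
  rw [hhx i (hi'.trans_le hl), hy' i hi']

end Prefixes

/-! ### Generic subsequences, patterns and squares -/

section Subsequences

/-- There are finitely many words of length `N`. They are treated one after another, each time
extending the word on `[N, M)` so that it also forces membership in `V` after the new prefix. -/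
theorem exists_block_forcing {V : Set (ℕ → Bool)} (hV : IsOpen V) (hd : Dense V) (N : ℕ) :
    ∃ M, N < M ∧ ∃ y : ℕ → Bool, ∀ x : ℕ → Bool, (∀ i, N ≤ i → i < M → x i = y i) → x ∈ V := by
  classical
  have key : ∀ S : Finset (Finset ℕ), ∃ M, N < M ∧ ∃ y : ℕ → Bool, ∀ x : ℕ → Bool,
      (∀ i, N ≤ i → i < M → x i = y i) → (∃ s ∈ S, ∀ i < N, x i = decide (i ∈ s)) → x ∈ V := by
    intro S
    induction S using Finset.induction_on with
    | empty => exact ⟨N + 1, N.lt_succ_self, fun _ => true, by simp⟩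
    | insert s S _ ih =>
      obtain ⟨M, hM, y, hy⟩ := ih
      let z : ℕ → Bool := fun i => if i < N then decide (i ∈ s) else y i
      obtain ⟨z', hz', hzV⟩ := hd.inter_open_nonempty _
        (isOpen_setOf_prefix (ι := id) continuous_id z M) ⟨z, fun _ _ => rfl⟩
      obtain ⟨l, hl⟩ := exists_cylinder_subset (ι := id) IsInducing.id hV hzV
      have hzM : ∀ i < M, z' i = z i := hz'
      refine ⟨max M l, lt_max_of_lt_left hM, z', fun x hx => ?_⟩
      rintro ⟨t, ht, hxt⟩
      rcases Finset.mem_insert.1 ht with rfl | ht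
      · refine hl x fun i hi => ?_
        change x i = z' i
        rcases lt_or_ge i N with hiN | hiN
        · rw [hxt i hiN, hzM i (hiN.trans hM)]
          exact (if_pos hiN).symm
        · exact hx i hiN (lt_max_of_lt_right hi)
      · refine hy x (fun i hiN hiM => ?_) ⟨t, ht, hxt⟩
        rw [hx i hiN (lt_max_of_lt_left hiM), hzM i hiM]
        exact if_neg hiN.not_gt
  obtain ⟨M, hM, y, hy⟩ := key (Finset.range N).powerset
  refine ⟨M, hM, y, fun x hx => hy x hx ⟨(Finset.range N).filter fun i => x i = true, by simp, ?_⟩⟩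
  intro i hi
  simp [hi]

/-- A comeagre set of sets of integers contains all the sets which coincide infinitely often with
a suitable pattern prescribed on successive intervals. -/
theorem exists_pattern_of_mem_residual {R : Set (ℕ → Bool)} (hR : R ∈ residual (ℕ → Bool)) :
    ∃ N : ℕ → ℕ, StrictMono N ∧ N 0 = 0 ∧ ∃ y : ℕ → ℕ → Bool, ∀ x : ℕ → Bool,
      (∃ᶠ k in atTop, ∀ i, N k ≤ i → i < N (k + 1) → x i = y k i) → x ∈ R := by
  obtain ⟨t, htR, ht, htd⟩ := mem_residual.1 hR
  obtain ⟨U, hU, rfl⟩ := isGδ_iff_eq_iInter_nat.1 ht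
  -- The sets `V n` decrease, so one agreement at some `k ≥ n` is enough to enter `U n`.
  let V : ℕ → Set (ℕ → Bool) := fun n => ⋂ k ∈ Finset.range (n + 1), U k
  have hVo : ∀ n, IsOpen (V n) := fun n => isOpen_biInter_finset fun k _ => hU k
  have hVd : ∀ n, Dense (V n) := fun n =>
    htd.mono (Set.subset_iInter₂ fun k _ => Set.iInter_subset _ k)
  choose M hM y hy using fun n => exists_block_forcing (hVo n) (hVd n)
  let N : ℕ → ℕ := fun n => Nat.rec 0 (fun k m => M k m) n
  refine ⟨N, strictMono_nat_of_lt_succ fun n => hM n (N n), rfl, fun k => y k (N k),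
    fun x hx => htR (Set.mem_iInter.2 fun n => ?_)⟩
  obtain ⟨k, hk, hxk⟩ := (frequently_atTop.1 hx) n
  exact Set.mem_iInter₂.1 (hy k (N k) x hxk) n (Finset.mem_range.2 (by omega))

variable {𝕜 : Type*} [RCLike 𝕜] {X : Type*} [NormedAddCommGroup X] [NormedSpace 𝕜 X]

/-- The subsequence of `v` given by a set of indices, with zeros at the other places. -/
def maskedSeq (v : ℕ → X) (x : ℕ → Bool) : ℕ → X := fun n => if x n then v n else 0

theorem continuous_maskedSeq (v : ℕ → X) : Continuous (maskedSeq v) :=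
  continuous_pi fun n => (continuous_of_discreteTopology
    (f := fun b : Bool => if b then v n else 0)).comp (continuous_apply n)

theorem closedSpan_maskedSeq (v : ℕ → X) (x : ℕ → Bool) :
    closedSpan 𝕜 (maskedSeq v x) = famSpan 𝕜 v {n | x n = true} := by
  rw [← famSpan_univ]
  refine le_antisymm (famSpan_le (isClosed_famSpan _ _) fun n _ => ?_)
    (famSpan_le (isClosed_famSpan _ _) fun n hn => ?_)
  · by_cases h : x n = true
    · simpa [maskedSeq, h] using mem_famSpan (𝕜 := 𝕜) (v := v) (D := {n | x n = true}) h
    · simp [maskedSeq, h]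
  · have hn' : x n = true := hn
    have : maskedSeq v x n = v n := by simp [maskedSeq, hn']
    rw [← this]
    exact mem_famSpan (Set.mem_univ n)

variable [CompleteSpace X] {b : UnconditionalSchauderBasis ℕ 𝕜 X} {v : ℕ → X}

/-- Prefixes with equally many ones select equally many vectors, so the exchange is a finite change.
-/
theorem prefixReplaceable_maskedSeq (hv : IsDisjointlySupported b v) (hv0 : ∀ n, v n ≠ 0)
    {l : ℕ} {x y : ℕ → Bool} (h : ((Finset.range l).filter fun i => x i = true).card =
      ((Finset.range l).filter fun i => y i = true).card) :
    PrefixReplaceable id (fun x y => SubspaceIso 𝕜 (closedSpan 𝕜 (maskedSeq v x))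
      (closedSpan 𝕜 (maskedSeq v y))) l x y := by
  intro z hz
  refine ⟨fun i => if i < l then y i else z i, fun i hi => if_pos hi,
    fun i hi => if_neg hi.not_gt, ?_⟩
  have hz : ∀ i < l, z i = x i := hz
  beta_reduce
  rw [closedSpan_maskedSeq, closedSpan_maskedSeq]
  have hD : ∀ A : Finset ℕ, A ⊆ Finset.range l →
      Disjoint (A : Set ℕ) {i | l ≤ i ∧ z i = true} := fun A hA =>
    Set.disjoint_left.2 fun i hi hi' => hi'.1.not_gt (Finset.mem_range.1 (hA hi))
  have := famSpan_equiv_of_finite_change hv hv0 hv hv0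
    (hD ((Finset.range l).filter fun i => y i = true) (Finset.filter_subset _ _))
    (hD ((Finset.range l).filter fun i => x i = true) (Finset.filter_subset _ _)) h.symm rfl
  have e1 : {n | (if n < l then y n else z n) = true} =
      ↑((Finset.range l).filter fun i => y i = true) ∪ {i | l ≤ i ∧ z i = true} := by
    ext i
    rcases lt_or_ge i l with hi | hi
    · simp [hi, hi.not_ge]
    · simp [hi, hi.not_gt]
  have e2 : {n | z n = true} =
      ↑((Finset.range l).filter fun i => x i = true) ∪ {i | l ≤ i ∧ z i = true} := by
    ext i
    rcases lt_or_ge i l with hi | hi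
    · simp [hi, hi.not_ge, hz i hi]
    · simp [hi, hi.not_gt]
  rw [e1, e2]
  exact this

/-- A word followed by its negation has as many ones as the word has letters. Any two prefixes of
length `l` thereby extend to prefixes with equally many ones. -/
theorem card_filter_append_not (x : ℕ → Bool) (l : ℕ) :
    ((Finset.range (l + l)).filter fun i =>
      (if i < l then x i else !(x (i - l))) = true).card = l := by
  rw [Finset.card_filter, Finset.sum_range_add, ← Finset.sum_add_distrib]
  conv_rhs => rw [← Finset.card_range l, Finset.card_eq_sum_ones]
  refine Finset.sum_congr rfl fun i hi => ?_
  cases h : x i <;> simp [Finset.mem_range.1 hi, h]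

theorem exists_pattern (hcount : IsCountablyHomogeneous 𝕜 X)
    (hv : IsDisjointlySupported b v) (hv0 : ∀ n, v n ≠ 0) :
    ∃ H : Submodule 𝕜 X, ∃ N : ℕ → ℕ, StrictMono N ∧ N 0 = 0 ∧ ∃ a : ℕ → Set ℕ, ∀ D : Set ℕ,
      (∃ᶠ k in atTop, ∀ i, N k ≤ i → i < N (k + 1) → (i ∈ D ↔ i ∈ a k)) →
        SubspaceIso 𝕜 (famSpan 𝕜 v D) H := by
  classical
  have := b.separableSpace
  have := polishSpace_of_countable_discrete Bool
  obtain ⟨x₀, hx₀⟩ := exists_residual_class hcount (continuous_maskedSeq v) fun U V hU hV hUn hVn =>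
    exists_homeomorph_of_prefixReplaceable (ι := id)
      (r := fun x y => SubspaceIso 𝕜 (closedSpan 𝕜 (maskedSeq v x)) (closedSpan 𝕜 (maskedSeq v y)))
      IsInducing.id Function.injective_id
      (fun t => SubspaceIso.refl _) (fun x y l => ⟨fun i => if i < l then x i else !(x (i - l)),
        fun i => if i < l then y i else !(y (i - l)), l + l, by omega, fun i hi => if_pos hi,
        fun i hi => if_pos hi,
        prefixReplaceable_maskedSeq hv hv0 (by
          rw [card_filter_append_not, card_filter_append_not]),
        prefixReplaceable_maskedSeq hv hv0 (by
          rw [card_filter_append_not, card_filter_append_not])⟩) hU hV hUn hVn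
  obtain ⟨N, hN, hN0, y, hy⟩ := exists_pattern_of_mem_residual hx₀
  refine ⟨closedSpan 𝕜 (maskedSeq v x₀), N, hN, hN0, fun k => {i | y k i = true}, fun D hD => ?_⟩
  have h := hy (fun i => decide (i ∈ D)) (hD.mono fun k hk i hi hi' => by
    have := hk i hi hi'
    rw [Bool.eq_iff_iff, decide_eq_true_iff]
    exact this)
  rw [Set.mem_ofPred_eq, closedSpan_maskedSeq] at h
  simpa using h

theorem StrictMono.existsUnique_interval {N : ℕ → ℕ} (hN : StrictMono N) (h0 : N 0 = 0) (i : ℕ) :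
    ∃ k, (N k ≤ i ∧ i < N (k + 1)) ∧ ∀ m, N m ≤ i → i < N (m + 1) → m = k := by
  classical
  have hex : ∃ k, i < N (k + 1) := ⟨i, i.lt_succ_self.trans_le (hN.id_le _)⟩
  refine ⟨Nat.find hex, ⟨?_, Nat.find_spec hex⟩, fun m h1 h2 => ?_⟩
  · rcases Nat.eq_zero_or_pos (Nat.find hex) with h | h
    · rw [h, h0]; exact Nat.zero_le _
    · have := Nat.find_min hex (Nat.sub_lt h one_pos)
      rwa [Nat.sub_add_cancel (show 1 ≤ Nat.find hex from h), not_lt] at this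
  · refine le_antisymm ?_ (Nat.find_min' hex h2)
    have := h1.trans_lt (Nat.find_spec hex)
    have := hN.lt_iff_lt.1 this
    omega

/-- In a countably homogeneous space, sparse subsequences of a disjointly supported sequence
span its closed span up to isomorphism, which is isomorphic to its square. -/
theorem exists_blocks_and_square (hcount : IsCountablyHomogeneous 𝕜 X)
    (hv : IsDisjointlySupported b v) (hv0 : ∀ n, v n ≠ 0) :
    (∃ a : ℕ → Finset ℕ, (∀ k, ∀ i ∈ a k, k ≤ i) ∧
      ∀ I : Set ℕ, I.Infinite → SubspaceIso 𝕜 (famSpan 𝕜 v (⋃ k ∈ I, (a k : Set ℕ)))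
        (closedSpan 𝕜 v)) ∧
    Nonempty (closedSpan 𝕜 v ≃L[𝕜] closedSpan 𝕜 v × closedSpan 𝕜 v) := by
  classical
  obtain ⟨H, N, hN, hN0, s, hs⟩ := exists_pattern hcount hv hv0
  let a : ℕ → Finset ℕ := fun k => (Finset.Ico (N k) (N (k + 1))).filter (· ∈ s k)
  have hmem : ∀ {k i}, i ∈ a k ↔ (N k ≤ i ∧ i < N (k + 1)) ∧ i ∈ s k := by
    intro k i
    simp [a]
  have huniq : ∀ {k m i}, N k ≤ i → i < N (k + 1) → N m ≤ i → i < N (m + 1) → k = m := by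
    intro k m i h1 h2 h3 h4
    obtain ⟨j, -, hj⟩ := hN.existsUnique_interval hN0 i
    rw [hj k h1 h2, hj m h3 h4]
  -- A union of blocks `a k` over an infinite `I` agrees with the pattern on every interval indexed
  -- by `I`.
  have hI : ∀ I : Set ℕ, I.Infinite → SubspaceIso 𝕜 (famSpan 𝕜 v (⋃ k ∈ I, (a k : Set ℕ))) H := by
    intro I hI
    refine hs _ ((Nat.frequently_atTop_iff_infinite.2 hI).mono fun k hk i h1 h2 => ?_)
    simp only [Set.mem_iUnion, Finset.mem_coe, exists_prop]
    constructor
    · rintro ⟨m, -, hm⟩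
      have hm' := hmem.1 hm
      obtain rfl := huniq h1 h2 hm'.1.1 hm'.1.2
      exact hm'.2
    · exact fun h => ⟨k, hk, hmem.2 ⟨⟨h1, h2⟩, h⟩⟩
  have heven : ∃ᶠ k in atTop, Even k := Nat.frequently_even
  have hodd : ∃ᶠ k in atTop, Odd k := Nat.frequently_odd
  have hHH : Nonempty (H ≃L[𝕜] H × H) := by
    obtain ⟨f⟩ := hI _ (Nat.frequently_atTop_iff_infinite.1 heven)
    obtain ⟨g⟩ := hI _ (Nat.frequently_atTop_iff_infinite.1 hodd)
    obtain ⟨k⟩ := hI _ Set.infinite_univ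
    have hdisj : Disjoint (⋃ k ∈ {k | Even k}, (a k : Set ℕ)) (⋃ k ∈ {k | Odd k}, (a k : Set ℕ)) := by
      refine Set.disjoint_iUnion₂_left.2 fun m hm => Set.disjoint_iUnion₂_right.2 fun n hn =>
        Set.disjoint_left.2 fun i hi hi' => ?_
      have h1 := hmem.1 hi
      have h2 := hmem.1 hi'
      obtain rfl := huniq h1.1.1 h1.1.2 h2.1.1 h2.1.2
      exact (Nat.not_even_iff_odd.2 hn) hm
    obtain ⟨φ⟩ := hv.famSpan_union hdisj
    rw [← Set.biUnion_union, show {k : ℕ | Even k} ∪ {k | Odd k} = Set.univ from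
      Set.eq_univ_of_forall fun k => Nat.even_or_odd k] at φ
    exact ⟨(k.symm.trans φ).trans (f.prodCongr g)⟩
  have hv' : SubspaceIso 𝕜 (closedSpan 𝕜 v) H := by
    -- `D` follows the pattern on even intervals and its complement on odd ones, so `D` and `Dᶜ`
    -- both match the pattern infinitely often.
    let D : Set ℕ := {i | ∃ k, (N k ≤ i ∧ i < N (k + 1)) ∧
      ((Even k ∧ i ∈ s k) ∨ (Odd k ∧ i ∉ s k))}
    obtain ⟨f⟩ := hs D (heven.mono fun k hk i h1 h2 => by
      constructor
      · rintro ⟨m, ⟨h3, h4⟩, h⟩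
        obtain rfl := huniq h1 h2 h3 h4
        exact (h.resolve_right fun h => (Nat.not_even_iff_odd.2 h.1) hk).2
      · exact fun h => ⟨k, ⟨h1, h2⟩, Or.inl ⟨hk, h⟩⟩)
    obtain ⟨g⟩ := hs Dᶜ (hodd.mono fun k hk i h1 h2 => by
      constructor
      · intro h
        by_contra h'
        exact h ⟨k, ⟨h1, h2⟩, Or.inr ⟨hk, h'⟩⟩
      · rintro h ⟨m, ⟨h3, h4⟩, h'⟩
        obtain rfl := huniq h1 h2 h3 h4
        exact h'.elim (fun h' => (Nat.not_even_iff_odd.2 hk) h'.1) fun h' => h'.2 h)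
    obtain ⟨φ⟩ := hv.famSpan_union (disjoint_compl_right (a := D))
    rw [Set.union_compl_self, famSpan_univ] at φ
    obtain ⟨k⟩ := hHH
    exact ⟨(φ.trans (f.prodCongr g)).trans k.symm⟩
  refine ⟨⟨a, fun k i hi => (hN.id_le k).trans (hmem.1 hi).1.1,
    fun I hI' => (hI I hI').trans hv'.symm⟩, ?_⟩
  obtain ⟨f⟩ := hv'
  obtain ⟨k⟩ := hHH
  exact ⟨(f.trans k).trans (f.prodCongr f).symm⟩

end Subsequences

/-! ### The Polish space of block-bases, and its generic elements -/

section BlockBases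

variable {𝕜 : Type*} [RCLike 𝕜] {X : Type*} [NormedAddCommGroup X] [NormedSpace 𝕜 X]

/-- Pełczyński's decomposition: `G ≃ S × R` and `S ≃ S × S` give `G ≃ S × G`; symmetrically `S ≃ G ×
S`. -/
theorem ContinuousLinearEquiv.nonempty_of_absorbing {G S R P : Type*}
    [AddCommGroup G] [AddCommGroup S] [AddCommGroup R] [AddCommGroup P]
    [TopologicalSpace G] [TopologicalSpace S] [TopologicalSpace R] [TopologicalSpace P]
    [Module 𝕜 G] [Module 𝕜 S] [Module 𝕜 R] [Module 𝕜 P]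
    (h₁ : G ≃L[𝕜] S × R) (h₂ : S ≃L[𝕜] S × S) (h₃ : S ≃L[𝕜] G × P) (h₄ : G ≃L[𝕜] G × G) :
    Nonempty (G ≃L[𝕜] S) := by
  have a : G ≃L[𝕜] S × G :=
    ((h₁.trans (h₂.prodCongr (ContinuousLinearEquiv.refl 𝕜 R))).trans
      (ContinuousLinearEquiv.prodAssoc 𝕜 S S R)).trans
      ((ContinuousLinearEquiv.refl 𝕜 S).prodCongr h₁.symm)
  have c : S ≃L[𝕜] G × S :=
    ((h₃.trans (h₄.prodCongr (ContinuousLinearEquiv.refl 𝕜 P))).trans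
      (ContinuousLinearEquiv.prodAssoc 𝕜 G G P)).trans
      ((ContinuousLinearEquiv.refl 𝕜 G).prodCongr h₃.symm)
  exact ⟨a.trans ((ContinuousLinearEquiv.prodComm 𝕜 S G).trans c.symm)⟩

variable {e : UnconditionalSchauderBasis ℕ 𝕜 X}

theorem coord_linearCombination (e : UnconditionalSchauderBasis ℕ 𝕜 X) (a : ℕ →₀ 𝕜) (i : ℕ) :
    e.coord i (Finsupp.linearCombination 𝕜 e.basis a) = a i := by
  classical
  simp +contextual [Finsupp.linearCombination_apply, Finsupp.sum, e.ortho, Pi.single_apply,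
    eq_comm]

theorem coordSupport_linearCombination (e : UnconditionalSchauderBasis ℕ 𝕜 X) (a : ℕ →₀ 𝕜) :
    coordSupport e (Finsupp.linearCombination 𝕜 e.basis a) = a.support := by
  ext i
  simp [coordSupport, coord_linearCombination]

namespace NormalizedRationalBlock

theorem exists_linearCombination (q : NormalizedRationalBlock 𝕜 e.basis) :
    ∃ a : ℕ →₀ 𝕜, a ≠ 0 ∧ q.1 = Finsupp.linearCombination 𝕜 e.basis a := by
  obtain ⟨x, hx, r, a, -, rfl⟩ := q
  refine ⟨(r : 𝕜) • a, fun h => ?_, (map_smul _ _ _).symm⟩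
  rw [← map_smul, h] at hx
  simp at hx

theorem ne_zero (q : NormalizedRationalBlock 𝕜 e.basis) : q.1 ≠ 0 := fun h => by
  have := q.2.1
  simp [h] at this

theorem finite_coordSupport (q : NormalizedRationalBlock 𝕜 e.basis) :
    (coordSupport e q.1).Finite := by
  obtain ⟨a, -, ha⟩ := q.exists_linearCombination
  rw [ha, coordSupport_linearCombination]
  exact a.support.finite_toSet

theorem nonempty_coordSupport (q : NormalizedRationalBlock 𝕜 e.basis) :
    (coordSupport e q.1).Nonempty := by
  obtain ⟨a, h0, ha⟩ := q.exists_linearCombination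
  rw [ha, coordSupport_linearCombination]
  exact Finset.coe_nonempty.2 (Finsupp.support_nonempty_iff.2 h0)

/-- The normalized basis vectors. -/
noncomputable def ofBasis (e : UnconditionalSchauderBasis ℕ 𝕜 X) (n : ℕ) :
    NormalizedRationalBlock 𝕜 e.basis :=
  ⟨((‖e.basis n‖⁻¹ : ℝ) : 𝕜) • e.basis n, by
    have h0 : e.basis n ≠ 0 := e.linearIndependent.ne_zero n
    have : ‖e.basis n‖ ≠ 0 := norm_ne_zero_iff.2 h0
    rw [norm_smul, RCLike.norm_ofReal, abs_of_nonneg (by positivity), inv_mul_cancel₀ this],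
    ‖e.basis n‖⁻¹, Finsupp.single n 1, fun i => by
      classical
      by_cases h : n = i
      · exact ⟨1, 0, by simp [h]⟩
      · exact ⟨0, 0, by simp [h]⟩, by simp⟩

theorem coordSupport_ofBasis (n : ℕ) : coordSupport e (ofBasis e n).1 ⊆ {n} := by
  classical
  intro i hi
  by_contra h
  have h : i ≠ n := h
  exact hi (by simp [ofBasis, e.ortho, h])

theorem exists_rational_section (𝕜 : Type*) [RCLike 𝕜] : ∃ g : 𝕜 → ℚ × ℚ, g 0 = 0 ∧
    ∀ t, IsRationalScalar 𝕜 t → ((g t).1 : 𝕜) + ((g t).2 : 𝕜) * RCLike.I = t := by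
  classical
  have h : ∀ t : 𝕜, ∃ p : ℚ × ℚ, (t = 0 → p = 0) ∧
      (IsRationalScalar 𝕜 t → (p.1 : 𝕜) + (p.2 : 𝕜) * RCLike.I = t) := by
    intro t
    by_cases h0 : t = 0
    · exact ⟨0, fun _ => rfl, fun _ => by simp [h0]⟩
    · by_cases ht : IsRationalScalar 𝕜 t
      · obtain ⟨p, q, hpq⟩ := ht
        exact ⟨(p, q), fun h => absurd h h0, fun _ => hpq.symm⟩
      · exact ⟨0, fun _ => rfl, fun h => absurd h ht⟩
  choose g hg using h
  exact ⟨g, (hg 0).1 rfl, fun t => (hg t).2⟩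

/-- Norm one forces the real factor to be plus or minus the inverse norm of the rational block, so a
sign and rational coordinates determine the vector. -/
instance : Countable (NormalizedRationalBlock 𝕜 e.basis) := by
  classical
  obtain ⟨g, hg0, hg⟩ := exists_rational_section 𝕜
  let f : ℚ × ℚ → 𝕜 := fun p => (p.1 : 𝕜) + (p.2 : 𝕜) * RCLike.I
  have hf0 : f 0 = 0 := by simp [f]
  let y : (ℕ →₀ ℚ × ℚ) → X := fun c => Finsupp.linearCombination 𝕜 e.basis (c.mapRange f hf0)
  let F : Bool × (ℕ →₀ ℚ × ℚ) → X := fun p =>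
    (((if p.1 then ‖y p.2‖⁻¹ else -‖y p.2‖⁻¹ : ℝ)) : 𝕜) • y p.2
  have hsub : {x : X | ‖x‖ = 1 ∧ ∃ (r : ℝ) (a : ℕ →₀ 𝕜), (∀ i, IsRationalScalar 𝕜 (a i)) ∧
      x = (r : 𝕜) • Finsupp.linearCombination 𝕜 e.basis a} ⊆ Set.range F := by
    rintro x ⟨hx, r, a, ha, rfl⟩
    have hya : y (a.mapRange g hg0) = Finsupp.linearCombination 𝕜 e.basis a := by
      change Finsupp.linearCombination 𝕜 e.basis _ = _
      congr 1
      ext i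
      simpa [f] using hg (a i) (ha i)
    rw [norm_smul, RCLike.norm_ofReal] at hx
    have hr : |r| = ‖Finsupp.linearCombination 𝕜 e.basis a‖⁻¹ := eq_inv_of_mul_eq_one_left hx
    rcases abs_choice r with h | h
    · exact ⟨(true, a.mapRange g hg0), by simp [F, hya, ← hr, h]⟩
    · refine ⟨(false, a.mapRange g hg0), ?_⟩
      have h' : -|r| = r := by rw [h, neg_neg]
      simp only [F, hya, ← hr, Bool.false_eq_true, if_false, h']
  exact ((Set.countable_range F).mono hsub).to_subtype

/-- The support of `p` precedes the support of `q`. -/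
def Before (p q : NormalizedRationalBlock 𝕜 e.basis) : Prop :=
  ∀ i ∈ coordSupport e p.1, ∀ j ∈ coordSupport e q.1, i < j

theorem Before.trans {p q r : NormalizedRationalBlock 𝕜 e.basis} (h : Before p q)
    (h' : Before q r) : Before p r := by
  intro i hi j hj
  obtain ⟨k, hk⟩ := q.nonempty_coordSupport
  exact (h i hi k hk).trans (h' k hk j hj)

end NormalizedRationalBlock

open NormalizedRationalBlock

/-- Turns blocking into a condition on consecutive terms, which makes `bb_d` closed in the product
and lets block-bases be glued. -/
theorem isBlocking_iff_before (x : ℕ → NormalizedRationalBlock 𝕜 e.basis) :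
    IsBlocking 𝕜 e.basis (fun n => (x n).1) ↔ ∀ n, Before (x n) (x (n + 1)) := by
  constructor
  · rintro ⟨a, ha, h⟩ n i hi j hj
    have h1 := (ha n).2
    have h2 := (ha (n + 1)).2
    beta_reduce at h1 h2
    rw [h1, coordSupport_linearCombination] at hi
    rw [h2, coordSupport_linearCombination] at hj
    exact h n i hi j hj
  · intro h
    choose a ha using fun n => (x n).exists_linearCombination
    refine ⟨a, ha, fun n i hi j hj => h n i ?_ j ?_⟩
    · rwa [(ha n).2, coordSupport_linearCombination]
    · rwa [(ha (n + 1)).2, coordSupport_linearCombination]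

namespace BlockBasesD

/-- The block-basis with given successive terms. -/
def ofBefore (x : ℕ → NormalizedRationalBlock 𝕜 e.basis)
    (h : ∀ n, Before (x n) (x (n + 1))) : BlockBasesD 𝕜 e.basis :=
  ⟨x, (isBlocking_iff_before x).2 h⟩

/-- The vectors of a block-basis. -/
def seq (x : BlockBasesD 𝕜 e.basis) : ℕ → X := fun n => (x.1 n).1

theorem before_succ (x : BlockBasesD 𝕜 e.basis) (n : ℕ) : Before (x.1 n) (x.1 (n + 1)) :=
  (isBlocking_iff_before x.1).1 x.2 n

theorem before (x : BlockBasesD 𝕜 e.basis) {m n : ℕ} (h : m < n) : Before (x.1 m) (x.1 n) := by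
  induction n, h using Nat.le_induction with
  | base => exact x.before_succ m
  | succ n _ ih => exact ih.trans (x.before_succ n)

theorem le_of_mem_coordSupport (x : BlockBasesD 𝕜 e.basis) (n : ℕ) :
    ∀ i ∈ coordSupport e (x.1 n).1, n ≤ i := by
  induction n with
  | zero => exact fun i _ => Nat.zero_le i
  | succ n ih =>
    intro i hi
    obtain ⟨k, hk⟩ := (x.1 n).nonempty_coordSupport
    exact (ih k hk).trans_lt (x.before_succ n k hk i hi)

theorem isDisjointlySupported (x : BlockBasesD 𝕜 e.basis) : IsDisjointlySupported e x.seq := by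
  intro m n hmn
  refine Set.disjoint_left.2 fun i hi hi' => ?_
  rcases lt_or_gt_of_ne hmn with h | h
  · exact lt_irrefl i (x.before h i hi i hi')
  · exact lt_irrefl i (x.before h i hi' i hi)

theorem seq_ne_zero (x : BlockBasesD 𝕜 e.basis) (n : ℕ) : x.seq n ≠ 0 :=
  (x.1 n).ne_zero

theorem isClosedEmbedding_val : IsClosedEmbedding
    (fun x : BlockBasesD 𝕜 e.basis => (x.1 : ℕ → NormalizedRationalBlock 𝕜 e.basis)) := by
  refine IsClosed.isClosedEmbedding_subtypeVal (s := {x : ℕ → NormalizedRationalBlock 𝕜 e.basis |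
    IsBlocking 𝕜 e.basis (fun n => (x n).1)}) ?_
  simp only [isBlocking_iff_before]
  rw [Set.ofPred_forall]
  refine isClosed_iInter fun n => ?_
  have hc : Continuous fun x : ℕ → NormalizedRationalBlock 𝕜 e.basis => (x n, x (n + 1)) :=
    (continuous_apply n).prodMk (continuous_apply (n + 1))
  have hd : IsClosed {p : NormalizedRationalBlock 𝕜 e.basis × NormalizedRationalBlock 𝕜 e.basis |
      Before p.1 p.2} := isClosed_discrete _
  exact hd.preimage hc

instance : PolishSpace (BlockBasesD 𝕜 e.basis) := by
  have := polishSpace_of_countable_discrete (NormalizedRationalBlock 𝕜 e.basis)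
  exact isClosedEmbedding_val.polishSpace

/-- The normalized basis, as a block-basis. -/
noncomputable def normalizedBasis (e : UnconditionalSchauderBasis ℕ 𝕜 X) :
    BlockBasesD 𝕜 e.basis :=
  ofBefore (ofBasis e) fun n i hi j hj => by
    rw [coordSupport_ofBasis n hi, coordSupport_ofBasis (n + 1) hj]
    exact n.lt_succ_self

instance : Nonempty (BlockBasesD 𝕜 e.basis) := ⟨normalizedBasis e⟩

theorem continuous_seq : Continuous (seq : BlockBasesD 𝕜 e.basis → ℕ → X) :=
  continuous_pi fun n => (continuous_of_discreteTopology
    (f := fun q : NormalizedRationalBlock 𝕜 e.basis => q.1)).comp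
      ((continuous_apply n).comp isClosedEmbedding_val.continuous)

/-- The last term of the prefix has finite support, while the supports of the terms of `y` tend to
infinity. -/
theorem exists_prefix_append (x y : BlockBasesD 𝕜 e.basis) (l : ℕ) : ∃ m₀, ∀ m, m₀ ≤ m →
    ∃ z : BlockBasesD 𝕜 e.basis, (∀ i < l, z.1 i = x.1 i) ∧ ∀ i, z.1 (l + i) = y.1 (m + i) := by
  have hm₀ : ∃ m₀, ∀ m, m₀ ≤ m → ∀ n, n + 1 = l → Before (x.1 n) (y.1 m) := by
    obtain _ | n := l
    · exact ⟨0, fun _ _ _ h => absurd h (Nat.succ_ne_zero _)⟩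
    · obtain ⟨B, hB⟩ := (x.1 n).finite_coordSupport.bddAbove
      refine ⟨B + 1, fun m hm n' hn' i hi j hj => ?_⟩
      obtain rfl : n' = n := Nat.succ_injective hn'
      have h1 := hB hi
      have h2 := y.le_of_mem_coordSupport m j hj
      omega
  obtain ⟨m₀, h⟩ := hm₀
  refine ⟨m₀, fun m hm => ⟨ofBefore (fun i => if i < l then x.1 i else y.1 (m + (i - l)))
    fun n => ?_, fun i hi => if_pos hi, fun i => ?_⟩⟩
  · rcases lt_trichotomy (n + 1) l with h1 | h1 | h1
    · rw [if_pos h1, if_pos (by omega)]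
      exact x.before_succ n
    · rw [if_pos (by omega), if_neg (by omega), show n + 1 - l = 0 by omega]
      exact h m hm n h1
    · rw [if_neg (by omega), if_neg (by omega), show m + (n + 1 - l) = m + (n - l) + 1 by omega]
      exact y.before_succ _
  · change ite _ _ _ = _
    rw [if_neg (by omega), Nat.add_sub_cancel_left]

/-- Any finite prefix can be continued by a tail of `v`, which contains all sufficiently late
blocks; this gives density. Openness holds because each occurrence involves finitely many terms. -/
theorem residual_exists_block (v : BlockBasesD 𝕜 e.basis) {a : ℕ → Finset ℕ}
    (ha : ∀ k, ∀ i ∈ a k, k ≤ i) (K : ℕ) :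
    {x : BlockBasesD 𝕜 e.basis | ∃ k, K ≤ k ∧ ∀ i ∈ a k, ∃ n, K ≤ n ∧ x.1 n = v.1 i} ∈
      residual (BlockBasesD 𝕜 e.basis) := by
  refine residual_of_dense_open ?_ (dense_iff_inter_open.2 fun U hU => ?_)
  · have : {x : BlockBasesD 𝕜 e.basis | ∃ k, K ≤ k ∧ ∀ i ∈ a k, ∃ n, K ≤ n ∧ x.1 n = v.1 i} =
        ⋃ k, ⋃ _ : K ≤ k, ⋂ i ∈ a k, ⋃ n, ⋃ _ : K ≤ n, {x | x.1 n = v.1 i} := by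
      ext x
      simp
    rw [this]
    refine isOpen_iUnion fun k => isOpen_iUnion fun _ => isOpen_biInter_finset fun i _ =>
      isOpen_iUnion fun n => isOpen_iUnion fun _ => ?_
    exact (isOpen_discrete {v.1 i}).preimage
      ((continuous_apply n).comp isClosedEmbedding_val.continuous)
  · rintro ⟨x, hx⟩
    obtain ⟨l, hl⟩ := exists_cylinder_subset isClosedEmbedding_val.isInducing hU hx
    obtain ⟨m, hm⟩ := exists_prefix_append x v (max l K)
    obtain ⟨z, hz1, hz2⟩ := hm (max m K) (le_max_left _ _)
    refine ⟨z, hl z fun i hi => hz1 i (lt_max_of_lt_left hi), max m K, le_max_right _ _,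
      fun i hi => ⟨max l K + (i - max m K), (le_max_right l K).trans (Nat.le_add_right _ _), ?_⟩⟩
    rw [hz2, Nat.add_sub_cancel' (ha _ i hi)]

theorem exists_subsequence (x : BlockBasesD 𝕜 e.basis) {D : Set ℕ} (hD : D.Infinite) :
    ∃ y : BlockBasesD 𝕜 e.basis, y.space = famSpan 𝕜 x.seq D := by
  classical
  refine ⟨ofBefore (fun n => x.1 (Nat.nth (· ∈ D) n)) fun n =>
    x.before (Nat.nth_strictMono hD n.lt_succ_self), ?_⟩
  change closedSpan 𝕜 (fun n => x.seq (Nat.nth (· ∈ D) n)) = _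
  rw [← famSpan_univ]
  refine famSpan_congr ?_
  rw [← Set.image_image (g := x.seq) (f := Nat.nth (· ∈ D)), Set.image_univ]
  exact congrArg (Set.image x.seq) (Nat.range_nth_of_infinite (p := (· ∈ D)) hD)

variable [CompleteSpace X]

/-- The shared term at position `l` keeps the supports successive at the junction, and `l + 1`
vectors replace `l + 1` others. -/
theorem prefixReplaceable {x y : BlockBasesD 𝕜 e.basis} {l : ℕ} (h : x.1 l = y.1 l) :
    PrefixReplaceable (fun x : BlockBasesD 𝕜 e.basis => x.1)
      (fun x y => SubspaceIso 𝕜 (closedSpan 𝕜 x.seq) (closedSpan 𝕜 y.seq)) (l + 1) x y := by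
  intro z hz
  refine ⟨ofBefore (fun i => if i < l + 1 then y.1 i else z.1 i) fun n => ?_,
    fun i hi => if_pos hi, fun i hi => if_neg hi.not_gt, ?_⟩
  · rcases lt_trichotomy n l with h1 | h1 | h1
    · rw [if_pos (by omega), if_pos (by omega)]
      exact y.before_succ n
    · subst h1
      rw [if_pos (by omega), if_neg (by omega)]
      have hzn : y.1 n = z.1 n := h.symm.trans (hz n n.lt_succ_self).symm
      exact hzn ▸ z.before_succ n
    · rw [if_neg (by omega), if_neg (by omega)]
      exact z.before_succ n
  · set w := ofBefore (fun i => if i < l + 1 then y.1 i else z.1 i) _ with hw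
    have hwz : ∀ i, l + 1 ≤ i → w.seq i = z.seq i := fun i hi =>
      congrArg Subtype.val (if_neg hi.not_gt)
    have hD : Disjoint ((Finset.range (l + 1) : Finset ℕ) : Set ℕ) {i | l + 1 ≤ i} :=
      Set.disjoint_left.2 fun i hi hi' => (Finset.mem_range.1 hi).not_ge hi'
    have := famSpan_equiv_of_finite_change w.isDisjointlySupported w.seq_ne_zero
      z.isDisjointlySupported z.seq_ne_zero hD hD rfl
      (Set.image_congr fun i hi => hwz i hi)
    have hu : ((Finset.range (l + 1) : Finset ℕ) : Set ℕ) ∪ {i | l + 1 ≤ i} = Set.univ :=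
      Set.eq_univ_of_forall fun i => (lt_or_ge i (l + 1)).imp (fun h => by simpa using h) id
    rwa [hu, famSpan_univ, famSpan_univ] at this

theorem exists_residual_isoClass (hcount : IsCountablyHomogeneous 𝕜 X) :
    ∃ c : IsoClass 𝕜 e.basis, IsResidualClass c := by
  have := e.separableSpace
  obtain ⟨x₀, hx₀⟩ := exists_residual_class hcount (continuous_seq (e := e)) fun U V hU hV hUn hVn =>
    exists_homeomorph_of_prefixReplaceable isClosedEmbedding_val.isInducing
      isClosedEmbedding_val.injective
      (r := fun x y => SubspaceIso 𝕜 (closedSpan 𝕜 x.seq) (closedSpan 𝕜 y.seq))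
      (fun t => SubspaceIso.refl _) (fun x y l => by
        obtain ⟨m, hm⟩ := exists_prefix_append x (normalizedBasis e) l
        obtain ⟨n, hn⟩ := exists_prefix_append y (normalizedBasis e) l
        obtain ⟨x', hx1, hx2⟩ := hm (max m n) (le_max_left _ _)
        obtain ⟨y', hy1, hy2⟩ := hn (max m n) (le_max_right _ _)
        -- Both prefixes are continued with the same tail of the normalized basis, so the terms at
        -- position `l` coincide.
        have h : x'.1 l = y'.1 l := (hx2 0).trans (hy2 0).symm
        exact ⟨x', y', l + 1, l.le_succ, hx1, hy1, prefixReplaceable h,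
          prefixReplaceable h.symm⟩) hU hV hUn hVn
  refine ⟨x₀.isoClass, ?_⟩
  rw [IsResidualClass]
  convert hx₀ using 1
  ext t
  exact Quotient.eq (r := isoSetoid 𝕜 e.basis)

end BlockBasesD

theorem countable_isoClass (hcount : IsCountablyHomogeneous 𝕜 X) :
    Countable (IsoClass 𝕜 e.basis) := by
  obtain ⟨W, hW⟩ := hcount
  choose f _ hf using fun c : IsoClass 𝕜 e.basis => hW _ (isClosed_closedSpan (Quotient.out c).seq)
  refine Function.Injective.countable (f := f) fun c d h => ?_
  rw [← Quotient.out_eq c, ← Quotient.out_eq d]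
  exact Quotient.sound ((hf c).trans (h ▸ (hf d).symm))

/-- If sequences `v c` have blocks appearing infinitely often in `x`, then all of them can be
followed along pairwise disjoint subsequences of `x`. -/
theorem exists_disjoint_subsequences {C Y : Type*} [Countable C] [Nonempty C] (x : ℕ → Y)
    (v : C → ℕ → Y) (a : C → ℕ → Finset ℕ)
    (h : ∀ c K, ∃ k, K ≤ k ∧ ∀ i ∈ a c k, ∃ n, K ≤ n ∧ x n = v c i) :
    ∃ D : C → Set ℕ, (Pairwise fun c d => Disjoint (D c) (D d)) ∧
      ∀ c, ∃ I : Set ℕ, I.Infinite ∧ x '' D c = v c '' ⋃ k ∈ I, (a c k : Set ℕ) := by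
  classical
  have h' : ∀ c K, ∃ k, K ≤ k ∧ ∃ p : Finset ℕ, (∀ n ∈ p, K ≤ n) ∧
      x '' p = v c '' (a c k : Set ℕ) := by
    intro c K
    obtain ⟨k, hk, H⟩ := h c K
    choose! n hn hx using H
    refine ⟨k, hk, (a c k).image n, fun m hm => ?_, ?_⟩
    · obtain ⟨i, hi, rfl⟩ := Finset.mem_image.1 hm
      exact hn i hi
    · rw [Finset.coe_image, Set.image_image]
      exact Set.image_congr hx
  choose k hk p hp hxp using h'
  obtain ⟨s, hs⟩ := exists_surjective_nat C
  -- Stage `j` serves the class `σ j`, and unpairing makes each class recur infinitely often. `B j`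
  -- bounds strictly all positions used before stage `j`, so the stages use disjoint positions.
  let σ : ℕ → C := fun j => s j.unpair.1
  let B : ℕ → ℕ := fun j => Nat.rec 0 (fun j m => max (m + 1) ((p (σ j) m).sup id + 1)) j
  have hB : ∀ j, B (j + 1) = max (B j + 1) ((p (σ j) (B j)).sup id + 1) := fun j => rfl
  have hBmono : StrictMono B := strictMono_nat_of_lt_succ fun j => by rw [hB]; omega
  have hpB : ∀ j, ∀ n ∈ p (σ j) (B j), n < B (j + 1) := fun j n hn => by
    have : n ≤ (p (σ j) (B j)).sup id := Finset.le_sup (f := id) hn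
    rw [hB]
    omega
  refine ⟨fun c => ⋃ j ∈ {j | σ j = c}, (p (σ j) (B j) : Set ℕ), fun c d hcd => ?_, fun c =>
    ⟨(fun j => k (σ j) (B j)) '' {j | σ j = c}, ?_, ?_⟩⟩
  · refine Set.disjoint_iUnion₂_left.2 fun i hi => Set.disjoint_iUnion₂_right.2 fun j hj =>
      Set.disjoint_left.2 fun n hn hn' => ?_
    have hij : i ≠ j := by
      rintro rfl
      exact hcd (hi.symm.trans hj)
    rcases lt_or_gt_of_ne hij with hlt | hlt
    · exact ((hpB i n hn).trans_le (hBmono.monotone hlt)).not_ge (hp _ _ n hn')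
    · exact ((hpB j n hn').trans_le (hBmono.monotone hlt)).not_ge (hp _ _ n hn)
  · refine Set.infinite_of_forall_exists_gt fun n => ?_
    obtain ⟨m, hm⟩ := hs c
    refine ⟨_, ⟨Nat.pair m (n + 1), by simp [σ, hm], rfl⟩, ?_⟩
    exact (Nat.right_le_pair m (n + 1)).trans ((hBmono.id_le _).trans (hk _ _))
  · rw [Set.biUnion_image, Set.image_iUnion₂, Set.image_iUnion₂]
    refine Set.iUnion₂_congr fun j hj => ?_
    rw [hxp, show σ j = c from hj]

end BlockBases

/-- Countable homogeneity already makes every block-subspace isomorphic to the span of each of its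
subsequences following a suitable sparse pattern, so the hypothesis of hereditary
block-minimality `hmin` is not used. -/
theorem mainTheorem11 {𝕜 : Type*} [RCLike 𝕜] {X : Type*} [NormedAddCommGroup X]
    [NormedSpace 𝕜 X] [CompleteSpace X]
    (e : UnconditionalSchauderBasis ℕ 𝕜 X)
    (hcount : IsCountablyHomogeneous 𝕜 X)
    (hmin : IsHereditarilyBlockMinimal 𝕜 e.basis) :
    (∃! c : IsoClass 𝕜 e.basis, IsResidualClass c) ∧
    ∀ x : BlockBasesD 𝕜 e.basis, IsResidualClass x.isoClass →
      ∃ y : IsoClass 𝕜 e.basis → BlockBasesD 𝕜 e.basis,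
        (∀ c, (y c).isoClass = c) ∧
        ∃ S : Submodule 𝕜 X,
          IsUnconditionalDirectSum (fun c => (y c).space) S ∧
          SubspaceIso 𝕜 x.space S := by
  constructor
  · obtain ⟨c, hc⟩ := BlockBasesD.exists_residual_isoClass (e := e) hcount
    refine ⟨c, hc, fun d hd => ?_⟩
    -- Two residual classes meet, by Baire, and therefore coincide.
    obtain ⟨t, ht, ht'⟩ := (dense_of_mem_residual (inter_mem hd hc)).nonempty
    exact Eq.trans (Eq.symm ht) ht'
  · intro x hx
    have := countable_isoClass (e := e) hcount
    have : Nonempty (IsoClass 𝕜 e.basis) := ⟨x.isoClass⟩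
    choose a ha haI using fun c : IsoClass 𝕜 e.basis =>
      (exists_blocks_and_square hcount (Quotient.out c).isDisjointlySupported
        (Quotient.out c).seq_ne_zero).1
    -- A generic `t` is isomorphic to `x` and contains late blocks of every class; `S` is built
    -- inside `[t]` and carried back to `x`.
    obtain ⟨t, htx, ht⟩ := (dense_of_mem_residual (inter_mem hx
      (countable_iInter_mem.2 fun c : IsoClass 𝕜 e.basis => countable_iInter_mem.2 fun K =>
        BlockBasesD.residual_exists_block (Quotient.out c) (ha c) K))).nonempty
    obtain ⟨D, hD, hDI⟩ := exists_disjoint_subsequences (C := IsoClass 𝕜 e.basis) t.seq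
      (fun c => (Quotient.out c).seq) a
      fun c K => by
        obtain ⟨k, hk, h⟩ := Set.mem_iInter.1 (Set.mem_iInter.1 ht c) K
        exact ⟨k, hk, fun i hi => (h i hi).imp fun n hn => ⟨hn.1, congrArg Subtype.val hn.2⟩⟩
    have hDc : ∀ c, SubspaceIso 𝕜 (famSpan 𝕜 t.seq (D c)) (Quotient.out c).space := by
      intro c
      obtain ⟨I, hI, himg⟩ := hDI c
      rw [famSpan_congr himg]
      exact haI c I hI
    have hind := fun z : BlockBasesD 𝕜 e.basis =>
      z.isDisjointlySupported.linearIndependent z.seq_ne_zero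
    have hDinf : ∀ c, (D c).Infinite := fun c =>
      infinite_of_famSpan_equiv (hind t) (hind (Quotient.out c)) (hDc c)
    choose y hy using fun c => t.exists_subsequence (hDinf c)
    refine ⟨y, fun c => ?_, famSpan 𝕜 t.seq (⋃ c, D c), ?_, ?_⟩
    · refine Eq.trans (Quotient.sound (s := BlockBasesD.isoSetoid 𝕜 e.basis) ?_)
        (Quotient.out_eq c)
      change SubspaceIso 𝕜 (y c).space (Quotient.out c).space
      rw [hy]
      exact hDc c
    · rw [funext hy]
      exact t.isDisjointlySupported.isUnconditionalDirectSum hD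
    · have htx' : SubspaceIso 𝕜 t.space x.space := Quotient.exact htx
      refine htx'.symm.trans ?_
      -- Viewing `S` as the span of a subsequence `s` of `t` gives `S ≃ S × S`.
      obtain ⟨s, hs⟩ := t.exists_subsequence
        ((hDinf t.isoClass).mono (Set.subset_iUnion D t.isoClass))
      obtain ⟨h₁⟩ := t.isDisjointlySupported.famSpan_union
        (disjoint_compl_right (a := ⋃ c, D c))
      obtain ⟨h₂⟩ := (exists_blocks_and_square hcount s.isDisjointlySupported s.seq_ne_zero).2
      obtain ⟨h₃⟩ := t.isDisjointlySupported.famSpan_union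
        (disjoint_sdiff_self_right (x := D t.isoClass) (y := ⋃ c, D c))
      obtain ⟨h₄⟩ := (exists_blocks_and_square hcount t.isDisjointlySupported t.seq_ne_zero).2
      have hout : SubspaceIso 𝕜 (Quotient.out t.isoClass).space t.space :=
        Quotient.mk_out (s := BlockBasesD.isoSetoid 𝕜 e.basis) t
      obtain ⟨h₅⟩ := (hDc t.isoClass).trans hout
      rw [Set.union_compl_self, famSpan_univ] at h₁
      -- The summand of `S` indexed by the class of `t` itself provides the complemented copy of
      -- `[t]` in `S`.
      rw [Set.union_sdiff_cancel (Set.subset_iUnion D t.isoClass)] at h₃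
      change s.space ≃L[𝕜] s.space × s.space at h₂
      rw [hs] at h₂
      exact ContinuousLinearEquiv.nonempty_of_absorbing h₁ h₂
        (h₃.trans (h₅.prodCongr (ContinuousLinearEquiv.refl 𝕜 _))) h₄
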